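/- Consider two bosonic modes ("qumodes") with annihilation operators $a_1,a_2$, quadratures given by $a_j=(q_j+ip_j)/\sqrt2$, and Schwinger operators $S^0=\tfrac12(a_1^\dagger a_1+a_2^\dagger a_2)$, $S^x=\tfrac12(a_1^\dagger a_2+a_2^\dagger a_1)$, $S^y=\tfrac1{2i}(a_1^\dagger a_2-a_2^\dagger a_1)$, $S^z=\tfrac12(a_1^\dagger a_1-a_2^\dagger a_2)$. For $\alpha,\beta,\gamma,\delta\in\mathbb R$ and $\theta\in\mathbb R$ let $$U(\theta)=\exp\bigl[-i\theta(\alpha S^0+\beta S^x+\gamma S^y+\delta S^z)\bigr],\qquad U=U(1).$$ Let $Z$ be a complex symmetric $2\times2$ matrix with positive definite imaginary part, let $|\psi_Z\rangle$ be the Gaussian pure state with wavefunction $$\psi_Z(q)=\det(\operatorname{Im}Z)^{1/4}\,\pi^{-1/2}\exp\bigl(\tfrac i2 q^TZq\bigr),\qquad q\in\mathbb R^2,$$ and let $K=\begin{pmatrix}k_{11}&k_{12}\\k_{12}&k_{22}\end{pmatrix}=(I+iZ)(I-iZ)^{-1}$ be its adjacency matrix. Consider the constraints $$(\alpha+\delta)k_{11}+(\beta-i\gamma)k_{12}=0,\qquad(\beta+i\gamma)k_{12}+(\alpha-\delta)k_{22}=0,$$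 $$2\alpha k_{12}+(\beta-i\gamma)k_{22}+(\beta+i\gamma)k_{11}=0.\tag{$*$}$$ Then: 1. If $K$ satisfies $(*)$, then $U|\psi_Z\rangle=|\psi_Z\rangle$. 2. Put $r=\sqrt{\beta^2+\gamma^2+\delta^2}$. If none of $\alpha$, $\alpha+r$, $\alpha-r$ is a nonzero integer multiple of $2\pi$, then $U|\psi_Z\rangle=|\psi_Z\rangle$ if and only if $K$ satisfies $(*)$. 3. For all $\alpha,\beta,\gamma,\delta$: $U(\theta)|\psi_Z\rangle=|\psi_Z\rangle$ for every $\theta\in\mathbb R$ if and only if $K$ satisfies $(*)$. -/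

import Mathlib

open scoped BigOperators

noncomputable section

namespace Qumodes

/-! ## Two qumodes in the number basis

`n : Fin 2 → ℕ` labels the number state `|n 0, n 1⟩`; a vector is given by its amplitudes
`c n = ⟨n 0, n 1 | c⟩`. -/

/-- The Fock space of two qumodes: square-summable amplitudes in the number basis. -/
abbrev FockSpace : Type := lp (fun _ : Fin 2 → ℕ => ℂ) 2

/-- All families of amplitudes, square-summable or not. Polynomials in the ladder operators act on
all of them, so that unbounded operators need no separate domain. -/
abbrev Amplitudes : Type := (Fin 2 → ℕ) → ℂ

/-- The annihilation operator of qumode `i`: `a |n⟩ = √n |n - 1⟩`. -/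
def annih (i : Fin 2) : Module.End ℂ Amplitudes where
  toFun c := fun n => (Real.sqrt ((n i : ℝ) + 1) : ℂ) * c (n + Pi.single i 1)
  map_add' c d := by funext n; simp [mul_add]
  map_smul' r c := by funext n; simp; ring

/-- The creation operator of qumode `i`: `a† |n⟩ = √(n + 1) |n + 1⟩`.
(The amplitude vanishes where `n i = 0`.) -/
def create (i : Fin 2) : Module.End ℂ Amplitudes where
  toFun c := fun n => (Real.sqrt (n i : ℝ) : ℂ) * c (n - Pi.single i 1)
  map_add' c d := by funext n; simp [mul_add]
  map_smul' r c := by funext n; simp; ring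

/-- `S⁰ = (a₁† a₁ + a₂† a₂) / 2`. -/
def S0 : Module.End ℂ Amplitudes :=
  (1 / 2 : ℂ) • (create 0 * annih 0 + create 1 * annih 1)

/-- `Sˣ = (a₁† a₂ + a₂† a₁) / 2`. -/
def Sx : Module.End ℂ Amplitudes :=
  (1 / 2 : ℂ) • (create 0 * annih 1 + create 1 * annih 0)

/-- `Sʸ = (a₁† a₂ - a₂† a₁) / (2i)`. -/
def Sy : Module.End ℂ Amplitudes :=
  (1 / (2 * Complex.I) : ℂ) • (create 0 * annih 1 - create 1 * annih 0)

/-- `Sᶻ = (a₁† a₁ - a₂† a₂) / 2`. -/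
def Sz : Module.End ℂ Amplitudes :=
  (1 / 2 : ℂ) • (create 0 * annih 0 - create 1 * annih 1)

/-- The general real combination `α S⁰ + β Sˣ + γ Sʸ + δ Sᶻ`. -/
def generator (α β γ δ : ℝ) : Module.End ℂ Amplitudes :=
  (α : ℂ) • S0 + (β : ℂ) • Sx + (γ : ℂ) • Sy + (δ : ℂ) • Sz

/-- `exp[-i (α S⁰ + β Sˣ + γ Sʸ + δ Sᶻ)]` on amplitudes, through the exponential series, which
converges in every component because the generator preserves the total photon number
(`hasSum_evolve`). -/
def evolve (α β γ δ : ℝ) (c : Amplitudes) : Amplitudes := fun n =>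
  ∑' k : ℕ, ((-Complex.I) ^ k / (k.factorial : ℂ)) * ((generator α β γ δ ^ k) c) n

/-! ### The exponential is a well-defined unitary operator -/

/-- The two-component label of a pair. -/
def lab (p : ℕ × ℕ) : Fin 2 → ℕ := ![p.1, p.2]

/-- Inner product of the parts of total photon number `m`. -/
def secInner (m : ℕ) (c d : Amplitudes) : ℂ :=
  ∑ p ∈ Finset.HasAntidiagonal.antidiagonal m, (starRingEnd ℂ) (c (lab p)) * d (lab p)

theorem secInner_conj (m : ℕ) (c d : Amplitudes) :
    (starRingEnd ℂ) (secInner m c d) = secInner m d c := by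
  simp only [secInner, map_sum, map_mul, Complex.conj_conj]
  exact Finset.sum_congr rfl fun p _ => mul_comm _ _

theorem secInner_create_zero (i : Fin 2) (c d : Amplitudes) :
    secInner 0 (create i c) d = 0 := by
  fin_cases i <;> simp [secInner, create, lab]

theorem secInner_create_succ (m : ℕ) (i : Fin 2) (c d : Amplitudes) :
    secInner (m + 1) (create i c) d = secInner m c (annih i d) := by
  fin_cases i
  · simp only [secInner, Finset.Nat.antidiagonal_succ, Finset.sum_cons, Finset.sum_map]
    have h (a b : ℕ) : (![a + 1, b] : Fin 2 → ℕ) - Pi.single 0 1 = ![a, b] := by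
      funext j; fin_cases j <;> simp
    have h' (a b : ℕ) : (![a, b] : Fin 2 → ℕ) + Pi.single 0 1 = ![a + 1, b] := by
      funext j; fin_cases j <;> simp
    simp [create, annih, lab, h, h']
    exact Finset.sum_congr rfl fun p _ => by ring
  · simp only [secInner, Finset.Nat.antidiagonal_succ', Finset.sum_cons, Finset.sum_map]
    have h (a b : ℕ) : (![a, b + 1] : Fin 2 → ℕ) - Pi.single 1 1 = ![a, b] := by
      funext j; fin_cases j <;> simp
    have h' (a b : ℕ) : (![a, b] : Fin 2 → ℕ) + Pi.single 1 1 = ![a, b + 1] := by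
      funext j; fin_cases j <;> simp
    simp [create, annih, lab, h, h']
    exact Finset.sum_congr rfl fun p _ => by ring

theorem secInner_hop (m : ℕ) (i j : Fin 2) (c d : Amplitudes) :
    secInner m (create i (annih j c)) d = secInner m c (create j (annih i d)) := by
  cases m with
  | zero => rw [secInner_create_zero, ← secInner_conj, secInner_create_zero, map_zero]
  | succ m =>
    rw [secInner_create_succ, ← secInner_conj (m + 1), secInner_create_succ, secInner_conj]

theorem secInner_add_left (m : ℕ) (c c' d : Amplitudes) :
    secInner m (c + c') d = secInner m c d + secInner m c' d := by
  simp [secInner, add_mul, Finset.sum_add_distrib]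

theorem secInner_smul_left (m : ℕ) (r : ℂ) (c d : Amplitudes) :
    secInner m (r • c) d = (starRingEnd ℂ) r * secInner m c d := by
  simp [secInner, Finset.mul_sum, mul_assoc]

theorem secInner_add_right (m : ℕ) (c d d' : Amplitudes) :
    secInner m c (d + d') = secInner m c d + secInner m c d' := by
  simp [secInner, mul_add, Finset.sum_add_distrib]

theorem secInner_smul_right (m : ℕ) (r : ℂ) (c d : Amplitudes) :
    secInner m c (r • d) = r * secInner m c d := by
  simp only [secInner, Finset.mul_sum, Pi.smul_apply, smul_eq_mul]
  exact Finset.sum_congr rfl fun p _ => by ring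

theorem secInner_generator (m : ℕ) (α β γ δ : ℝ) (c d : Amplitudes) :
    secInner m (generator α β γ δ c) d = secInner m c (generator α β γ δ d) := by
  simp only [generator, S0, Sx, Sy, Sz, sub_eq_add_neg, ← neg_one_smul ℂ (_ * _),
    LinearMap.add_apply, LinearMap.smul_apply, Module.End.mul_apply, secInner_add_left,
    secInner_smul_left, secInner_add_right, secInner_smul_right, secInner_hop]
  simp only [map_div₀, map_one, map_ofNat, map_mul, map_neg, Complex.conj_I, Complex.conj_ofReal]
  have hI : (1 : ℂ) / (2 * Complex.I) = -Complex.I / 2 := by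
    field_simp; simp
  have hI' : (1 : ℂ) / (2 * -Complex.I) = Complex.I / 2 := by
    field_simp; simp
  rw [hI, hI']
  ring

/-- The part of total photon number `m`. -/
def res (m : ℕ) : Amplitudes →ₗ[ℂ] EuclideanSpace ℂ (Finset.HasAntidiagonal.antidiagonal m) where
  toFun c := WithLp.toLp 2 fun p => c (lab p.1)
  map_add' _ _ := rfl
  map_smul' _ _ := rfl

@[simp] theorem res_apply (m : ℕ) (c : Amplitudes) (p : Finset.HasAntidiagonal.antidiagonal m) :
    res m c p = c (lab p.1) := rfl

/-- Extension of a part of total photon number `m` by zero. -/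
def ext (m : ℕ) : EuclideanSpace ℂ (Finset.HasAntidiagonal.antidiagonal m) →ₗ[ℂ] Amplitudes where
  toFun v := fun n => if h : (n 0, n 1) ∈ Finset.HasAntidiagonal.antidiagonal m then v ⟨(n 0, n 1), h⟩ else 0
  map_add' v w := by funext n; dsimp only [Pi.add_apply, Pi.smul_apply, RingHom.id_apply]; split_ifs <;> simp
  map_smul' r v := by funext n; dsimp only [Pi.add_apply, Pi.smul_apply, RingHom.id_apply]; split_ifs <;> simp

theorem res_ext (m : ℕ) (v : EuclideanSpace ℂ (Finset.HasAntidiagonal.antidiagonal m)) : res m (ext m v) = v := by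
  refine PiLp.ext fun p => ?_
  have h : ((lab p.1) 0, (lab p.1) 1) = p.1 := by simp [lab]
  have h2 : ((lab p.1) 0, (lab p.1) 1) ∈ Finset.HasAntidiagonal.antidiagonal m := h ▸ p.2
  rw [res_apply]
  simp only [ext, LinearMap.coe_mk, AddHom.coe_mk, dif_pos h2]
  rfl

theorem inner_res (m : ℕ) (c d : Amplitudes) : inner ℂ (res m c) (res m d) = secInner m c d := by
  rw [PiLp.inner_apply, secInner, ← Finset.sum_coe_sort (Finset.HasAntidiagonal.antidiagonal m)
    (fun p => (starRingEnd ℂ) (c (lab p)) * d (lab p))]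
  refine Finset.sum_congr rfl fun p _ => ?_
  rw [RCLike.inner_apply, res_apply, res_apply, mul_comm]

theorem res_generator_eq_zero (m : ℕ) (α β γ δ : ℝ) (c : Amplitudes) (h : res m c = 0) :
    res m (generator α β γ δ c) = 0 := by
  rw [← inner_self_eq_zero (𝕜 := ℂ), inner_res, secInner_generator, ← inner_res, h,
    inner_zero_left]

/-- The generator restricted to total photon number `m`. -/
def secGen (m : ℕ) (α β γ δ : ℝ) :
    EuclideanSpace ℂ (Finset.HasAntidiagonal.antidiagonal m) →L[ℂ] EuclideanSpace ℂ (Finset.HasAntidiagonal.antidiagonal m) :=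
  LinearMap.toContinuousLinearMap (res m ∘ₗ generator α β γ δ ∘ₗ ext m)

theorem res_generator (m : ℕ) (α β γ δ : ℝ) (c : Amplitudes) :
    res m (generator α β γ δ c) = secGen m α β γ δ (res m c) := by
  have h := res_generator_eq_zero m α β γ δ (c - ext m (res m c)) (by simp [res_ext])
  rw [map_sub, map_sub, sub_eq_zero] at h
  rw [h]
  rfl

theorem res_generator_pow (m : ℕ) (α β γ δ : ℝ) (c : Amplitudes) (k : ℕ) :
    res m ((generator α β γ δ ^ k) c) = (secGen m α β γ δ ^ k) (res m c) := by
  induction k with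
  | zero => simp
  | succ k ih => rw [pow_succ', pow_succ', Module.End.mul_apply, res_generator, ih]; rfl

theorem hasSum_res (m : ℕ) (α β γ δ : ℝ) (c : Amplitudes) (p : Finset.HasAntidiagonal.antidiagonal m) :
    HasSum (fun k : ℕ => ((-Complex.I) ^ k / (k.factorial : ℂ)) *
      ((generator α β γ δ ^ k) c) (lab p.1))
      (NormedSpace.exp ((-Complex.I) • secGen m α β γ δ) (res m c) p) := by
  have h := NormedSpace.exp_series_hasSum_exp' (𝕂 := ℂ) ((-Complex.I) • secGen m α β γ δ)
  have h2 := h.mapL ((EuclideanSpace.proj p).comp (ContinuousLinearMap.apply ℂ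
    (EuclideanSpace ℂ (Finset.HasAntidiagonal.antidiagonal m)) (res m c)))
  have e : (fun k : ℕ => ((-Complex.I) ^ k / (k.factorial : ℂ)) *
      ((generator α β γ δ ^ k) c) (lab p.1)) = fun k : ℕ =>
      ((EuclideanSpace.proj p).comp (ContinuousLinearMap.apply ℂ
        (EuclideanSpace ℂ (Finset.HasAntidiagonal.antidiagonal m)) (res m c)))
        (((k.factorial : ℂ)⁻¹) • ((-Complex.I) • secGen m α β γ δ) ^ k) := by
    funext k
    have hk : ((generator α β γ δ ^ k) c) (lab p.1) = (secGen m α β γ δ ^ k) (res m c) p := by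
      rw [← res_generator_pow, res_apply]
    rw [hk]
    simp [smul_pow]
    ring
  rw [e]
  exact h2

theorem hasSum_evolve (α β γ δ : ℝ) (c : Amplitudes) (n : Fin 2 → ℕ) :
    HasSum (fun k : ℕ => ((-Complex.I) ^ k / (k.factorial : ℂ)) * ((generator α β γ δ ^ k) c) n)
      (evolve α β γ δ c n) := by
  have h := hasSum_res (n 0 + n 1) α β γ δ c ⟨(n 0, n 1), by simp⟩
  have hn : lab (n 0, n 1) = n := by funext j; fin_cases j <;> rfl
  rw [hn] at h
  exact h.summable.hasSum

theorem res_evolve (m : ℕ) (α β γ δ : ℝ) (c : Amplitudes) :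
    res m (evolve α β γ δ c) =
      NormedSpace.exp ((-Complex.I) • secGen m α β γ δ) (res m c) :=
  PiLp.ext fun p => (hasSum_res m α β γ δ c p).tsum_eq

theorem evolve_ext {c d : Amplitudes} (h : ∀ m, res m c = res m d) : c = d := by
  funext n
  have h1 : res (n 0 + n 1) c ⟨(n 0, n 1), by simp⟩ = res (n 0 + n 1) d ⟨(n 0, n 1), by simp⟩ := by
    rw [h]
  have hn : lab (n 0, n 1) = n := by funext j; fin_cases j <;> rfl
  simpa [hn] using h1

theorem evolve_add (α β γ δ : ℝ) (c d : Amplitudes) :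
    evolve α β γ δ (c + d) = evolve α β γ δ c + evolve α β γ δ d :=
  evolve_ext fun m => by simp only [map_add, res_evolve]

theorem evolve_smul (α β γ δ : ℝ) (r : ℂ) (c : Amplitudes) :
    evolve α β γ δ (r • c) = r • evolve α β γ δ c :=
  evolve_ext fun m => by simp only [map_smul, res_evolve]

theorem generator_neg (α β γ δ : ℝ) : generator (-α) (-β) (-γ) (-δ) = -generator α β γ δ := by
  simp only [generator, Complex.ofReal_neg]
  module

theorem secGen_neg (m : ℕ) (α β γ δ : ℝ) :
    secGen m (-α) (-β) (-γ) (-δ) = -secGen m α β γ δ := by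
  ext v : 1
  simp [secGen, generator_neg]

theorem exp_neg_exp_apply {E : Type*} [NormedAddCommGroup E] [InnerProductSpace ℂ E]
    [CompleteSpace E] (T : E →L[ℂ] E) (v : E) :
    NormedSpace.exp (-T) (NormedSpace.exp T v) = v := by
  let _ : NormedAlgebra ℚ (E →L[ℂ] E) := NormedAlgebra.restrictScalars ℚ ℂ _
  have h : NormedSpace.exp (-T) * NormedSpace.exp T = 1 := by
    rw [← NormedSpace.exp_add_of_commute (Commute.refl T).neg_left, neg_add_cancel,
      NormedSpace.exp_zero]
  exact congrArg (fun A : E →L[ℂ] E => A v) h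

theorem star_exp_mul {A : Type*} [NormedRing A] [NormedAlgebra ℂ A] [CompleteSpace A] [StarRing A] [ContinuousStar A] [StarModule ℂ A]
   (T : A) (hT : star T = T) : star (NormedSpace.exp ((-Complex.I) • T)) * NormedSpace.exp ((-Complex.I) • T) = 1 := by
  let _ : NormedAlgebra ℚ A := NormedAlgebra.restrictScalars ℚ ℂ _
  have h : (-Complex.I) • T ∈ skewAdjoint A := by
    rw [skewAdjoint.mem_iff, star_smul, hT]
    simp
  exact (NormedSpace.exp_mem_unitary_of_mem_skewAdjoint h).1

theorem norm_exp_apply {E : Type*} [NormedAddCommGroup E] [InnerProductSpace ℂ E]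
    [CompleteSpace E] (T : E →L[ℂ] E) (hT : IsSelfAdjoint T) (v : E) :
    ‖NormedSpace.exp ((-Complex.I) • T) v‖ = ‖v‖ := by
  have h := star_exp_mul T hT
  have h2 := congrArg (fun A : E →L[ℂ] E => inner ℂ (A v) v) h
  simp only [ContinuousLinearMap.star_eq_adjoint, mul_apply_eq_comp, ContinuousLinearMap.adjoint_inner_left, one_apply_eq_self] at h2
  rw [inner_self_eq_norm_sq_to_K, inner_self_eq_norm_sq_to_K] at h2
  norm_cast at h2
  exact (sq_eq_sq₀ (norm_nonneg _) (norm_nonneg _)).1 h2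

theorem evolve_neg_evolve (α β γ δ : ℝ) (c : Amplitudes) :
    evolve (-α) (-β) (-γ) (-δ) (evolve α β γ δ c) = c :=
  evolve_ext fun m => by
    rw [res_evolve, res_evolve, secGen_neg, smul_neg, exp_neg_exp_apply]

theorem evolve_evolve_neg (α β γ δ : ℝ) (c : Amplitudes) :
    evolve α β γ δ (evolve (-α) (-β) (-γ) (-δ) c) = c := by
  simpa using evolve_neg_evolve (-α) (-β) (-γ) (-δ) c

theorem secGen_isSelfAdjoint (m : ℕ) (α β γ δ : ℝ) : IsSelfAdjoint (secGen m α β γ δ) := by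
  rw [ContinuousLinearMap.isSelfAdjoint_iff_isSymmetric]
  intro v w
  have h (u : EuclideanSpace ℂ (Finset.HasAntidiagonal.antidiagonal m)) :
      secGen m α β γ δ u = res m (generator α β γ δ (ext m u)) := rfl
  have h2 := secInner_generator m α β γ δ (ext m v) (ext m w)
  rw [← inner_res, ← inner_res, res_ext, res_ext, ← h, ← h] at h2
  exact h2

theorem norm_res_evolve (m : ℕ) (α β γ δ : ℝ) (c : Amplitudes) :
    ‖res m (evolve α β γ δ c)‖ = ‖res m c‖ := by
  rw [res_evolve]
  exact norm_exp_apply _ (secGen_isSelfAdjoint m α β γ δ) _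

/-- Number states sorted by total photon number. -/
def sector : (Σ m : ℕ, Finset.HasAntidiagonal.antidiagonal m) ≃ (Fin 2 → ℕ) :=
  Finset.HasAntidiagonal.sigmaAntidiagonalEquivProd.trans (finTwoArrowEquiv ℕ).symm

theorem hasSum_fiber (c : Amplitudes) (m : ℕ) :
    HasSum (fun p : Finset.HasAntidiagonal.antidiagonal m => ‖c (sector ⟨m, p⟩)‖ ^ 2)
      (‖res m c‖ ^ 2) := by
  rw [EuclideanSpace.norm_sq_eq]
  exact hasSum_fintype (fun p : Finset.HasAntidiagonal.antidiagonal m => ‖c (sector ⟨m, p⟩)‖ ^ 2)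

theorem summable_iff_res (c : Amplitudes) :
    Summable (fun n => ‖c n‖ ^ 2) ↔ Summable (fun m => ‖res m c‖ ^ 2) := by
  rw [← sector.summable_iff, summable_sigma_of_nonneg fun _ => by simp]
  simp only [Function.comp_apply, (hasSum_fiber c _).tsum_eq]
  exact and_iff_right fun m => (hasSum_fiber c m).summable

theorem tsum_eq_tsum_res (c : Amplitudes) (h : Summable (fun n => ‖c n‖ ^ 2)) :
    ∑' n, ‖c n‖ ^ 2 = ∑' m, ‖res m c‖ ^ 2 := by
  rw [← sector.tsum_eq, Summable.tsum_sigma' (f := fun x => ‖c (sector x)‖ ^ 2) (fun m => (hasSum_fiber c m).summable)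
    (sector.summable_iff.2 h)]
  exact tsum_congr fun m => (hasSum_fiber c m).tsum_eq

theorem memℓp_iff (c : Amplitudes) : Memℓp c 2 ↔ Summable (fun n => ‖c n‖ ^ 2) := by
  rw [memℓp_gen_iff (by norm_num)]
  norm_num

theorem memℓp_evolve (α β γ δ : ℝ) {c : Amplitudes} (h : Memℓp c 2) :
    Memℓp (evolve α β γ δ c) 2 := by
  rw [memℓp_iff, summable_iff_res] at h ⊢
  simpa only [norm_res_evolve] using h

theorem tsum_evolve (α β γ δ : ℝ) {c : Amplitudes} (h : Memℓp c 2) :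
    ∑' n, ‖evolve α β γ δ c n‖ ^ 2 = ∑' n, ‖c n‖ ^ 2 := by
  rw [tsum_eq_tsum_res _ ((memℓp_iff _).1 h),
    tsum_eq_tsum_res _ ((memℓp_iff _).1 (memℓp_evolve α β γ δ h))]
  simp only [norm_res_evolve]

/-- The passive unitary `exp[-i (α S⁰ + β Sˣ + γ Sʸ + δ Sᶻ)]` on the Fock space. -/
def passiveUnitary (α β γ δ : ℝ) : FockSpace ≃ₗᵢ[ℂ] FockSpace where
  toFun φ := ⟨evolve α β γ δ φ, memℓp_evolve α β γ δ φ.2⟩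
  invFun φ := ⟨evolve (-α) (-β) (-γ) (-δ) φ, memℓp_evolve _ _ _ _ φ.2⟩
  map_add' φ χ := Subtype.ext (evolve_add α β γ δ φ χ)
  map_smul' r φ := Subtype.ext (evolve_smul α β γ δ r φ)
  left_inv φ := Subtype.ext (evolve_neg_evolve α β γ δ φ)
  right_inv φ := Subtype.ext (evolve_evolve_neg α β γ δ φ)
  norm_map' φ := by
    have h0 : (0 : ℝ) < (2 : ENNReal).toReal := by norm_num
    have key := tsum_evolve α β γ δ φ.2
    rw [lp.norm_eq_tsum_rpow h0, lp.norm_eq_tsum_rpow h0]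
    refine congrArg (· ^ (1 / (2 : ENNReal).toReal)) ?_
    have h3 (x : ℝ) : x ^ (2 : ENNReal).toReal = x ^ 2 := by norm_num
    exact (tsum_congr fun n => h3 _).trans (key.trans (tsum_congr fun n => (h3 _).symm))

/-! ## Gaussian pure states -/

/-- The number wavefunction `⟨x|n⟩` of one qumode (Hermite function), for `[q, p] = i` and
`a = (q + i p) / √2`. `Polynomial.hermite` is the probabilists' Hermite polynomial. -/
def numberWave (n : ℕ) (x : ℝ) : ℝ :=
  Polynomial.aeval (Real.sqrt 2 * x) (Polynomial.hermite n) * Real.exp (-(x ^ 2) / 2) /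
    (Real.pi ^ (1 / 4 : ℝ) * Real.sqrt (n.factorial : ℝ))

/-- The number-basis amplitudes `⟨n 0, n 1 | ψ⟩` of a position-space wavefunction. -/
def numberAmplitudes (ψ : (Fin 2 → ℝ) → ℂ) : Amplitudes := fun n =>
  ∫ q : Fin 2 → ℝ, ((∏ i, numberWave (n i) (q i) : ℝ) : ℂ) * ψ q

/-- `Z = V + i U` with `U` and `V` real symmetric and `U` positive definite. -/
structure IsGaussianGraph (Z : Matrix (Fin 2) (Fin 2) ℂ) : Prop where
  symm : Z.IsSymm
  posDef : (Z.map Complex.im).PosDef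

/-- The wavefunction
`ψ_Z(q) = det(U)^{1/4} π^{-n/4} exp((i/2) qᵀ Z q)` for `n = 2`, where `U = Im Z`. -/
def gaussianWave (Z : Matrix (Fin 2) (Fin 2) ℂ) (q : Fin 2 → ℝ) : ℂ :=
  (((Z.map Complex.im).det ^ (1 / 4 : ℝ) / Real.pi ^ (2 / 4 : ℝ) : ℝ) : ℂ) *
    Complex.exp (Complex.I / 2 * ∑ i, ∑ j, (q i : ℂ) * Z i j * (q j : ℂ))

open MeasureTheory in
theorem integrable_poly (p : Polynomial ℝ) :
    Integrable fun x : ℝ => p.eval x * Real.exp (-(x ^ 2) / 2) := by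
  induction p using Polynomial.induction_on' with
  | add p q hp hq =>
    exact (hp.add hq).congr (Filter.Eventually.of_forall fun x => by simp [add_mul])
  | monomial k a =>
    have h := (integrable_rpow_mul_exp_neg_mul_sq (b := 1 / 2) (by norm_num) (s := (k : ℝ))
      (by have : (0 : ℝ) ≤ k := k.cast_nonneg; linarith)).const_mul a
    refine h.congr (Filter.Eventually.of_forall fun x => ?_)
    simp only [Polynomial.eval_monomial, Real.rpow_natCast]
    rw [mul_assoc, show -(1 / 2) * x ^ 2 = -(x ^ 2) / 2 by ring]

/-- The Hermite polynomial with real coefficients. -/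
def herm (n : ℕ) : Polynomial ℝ := (Polynomial.hermite n).map (Int.castRingHom ℝ)

open Polynomial in
theorem herm_succ (n : ℕ) : herm (n + 1) = X * herm n - derivative (herm n) := by
  simp [herm, hermite_succ, derivative_map]

theorem eval_herm (n : ℕ) (x : ℝ) :
    Polynomial.aeval x (Polynomial.hermite n) = (herm n).eval x := by
  rw [herm, Polynomial.eval_map, Polynomial.aeval_def]
  rfl

open Polynomial in
theorem integral_herm_succ (p : Polynomial ℝ) (n : ℕ) :
    ∫ x : ℝ, (p * herm (n + 1)).eval x * Real.exp (-(x ^ 2) / 2) =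
      ∫ x : ℝ, (derivative p * herm n).eval x * Real.exp (-(x ^ 2) / 2) := by
  have hd (x : ℝ) : HasDerivAt (fun x : ℝ => (p * herm n).eval x * Real.exp (-(x ^ 2) / 2))
      ((derivative p * herm n - p * herm (n + 1)).eval x * Real.exp (-(x ^ 2) / 2)) x := by
    have h1 := (p * herm n).hasDerivAt x
    have h2 : HasDerivAt (fun x : ℝ => Real.exp (-(x ^ 2) / 2))
        (Real.exp (-(x ^ 2) / 2) * (-x)) x := by
      have h3 : HasDerivAt (fun x : ℝ => -(x ^ 2) / 2) (-x) x := by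
        refine (((hasDerivAt_pow 2 x).neg).div_const 2).congr_deriv ?_
        norm_num
        ring
      exact h3.exp
    refine (h1.mul h2).congr_deriv ?_
    simp [herm_succ]
    ring
  have h := MeasureTheory.integral_eq_zero_of_hasDerivAt_of_integrable hd
    (integrable_poly _) (integrable_poly _)
  simp only [eval_sub, sub_mul] at h
  rw [MeasureTheory.integral_sub (integrable_poly _) (integrable_poly _)] at h
  linarith

open Polynomial in
theorem integral_herm (p : Polynomial ℝ) (n : ℕ) :
    ∫ x : ℝ, (p * herm n).eval x * Real.exp (-(x ^ 2) / 2) =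
      ∫ x : ℝ, (derivative^[n] p).eval x * Real.exp (-(x ^ 2) / 2) := by
  induction n generalizing p with
  | zero => simp [herm]
  | succ n ih => rw [integral_herm_succ, ih, Function.iterate_succ_apply]

theorem integral_weight : ∫ x : ℝ, Real.exp (-(x ^ 2) / 2) = Real.sqrt (2 * Real.pi) := by
  have h := integral_gaussian (1 / 2)
  rw [show Real.pi / (1 / 2) = 2 * Real.pi by ring] at h
  rw [← h]
  congr 1; funext x; congr 1; ring

open Polynomial in
theorem integral_herm_herm_of_lt {m n : ℕ} (h : m < n) :
    ∫ x : ℝ, (herm m * herm n).eval x * Real.exp (-(x ^ 2) / 2) = 0 := by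
  rw [integral_herm, iterate_derivative_eq_zero]
  · simp
  · rw [herm]
    exact lt_of_le_of_lt natDegree_map_le (by rwa [natDegree_hermite])

open Polynomial in
theorem integral_herm_self (n : ℕ) :
    ∫ x : ℝ, (herm n * herm n).eval x * Real.exp (-(x ^ 2) / 2) =
      n.factorial * Real.sqrt (2 * Real.pi) := by
  have hm : (herm n).Monic := (hermite_monic n).map _
  have hn : (herm n).natDegree = n := by
    rw [herm, (hermite_monic n).natDegree_map, natDegree_hermite]
  have h : derivative^[n] (herm n) = C (n.factorial : ℝ) := by
    ext k
    rw [coeff_iterate_derivative, coeff_C]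
    rcases Nat.eq_zero_or_pos k with rfl | hk
    · have : (herm n).coeff n = 1 := by
        have h2 := hm.coeff_natDegree
        rwa [hn] at h2
      simp [this, Nat.descFactorial_self]
    · rw [coeff_eq_zero_of_natDegree_lt (by omega), smul_zero, if_neg (by omega)]
  rw [integral_herm, h]
  simp only [eval_C]
  rw [MeasureTheory.integral_const_mul, integral_weight]

theorem numberWave_mul (m n : ℕ) (x : ℝ) :
    numberWave m x * numberWave n x =
      (Real.sqrt Real.pi * (Real.sqrt m.factorial * Real.sqrt n.factorial))⁻¹ *
      ((herm m * herm n).eval (Real.sqrt 2 * x) * Real.exp (-((Real.sqrt 2 * x) ^ 2) / 2)) := by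
  have h1 : (Real.pi ^ (1 / 4 : ℝ)) * Real.pi ^ (1 / 4 : ℝ) = Real.sqrt Real.pi := by
    rw [← Real.rpow_add Real.pi_pos, Real.sqrt_eq_rpow]; norm_num
  have h2 : Real.exp (-((Real.sqrt 2 * x) ^ 2) / 2) =
      Real.exp (-(x ^ 2) / 2) * Real.exp (-(x ^ 2) / 2) := by
    rw [← Real.exp_add, mul_pow, Real.sq_sqrt (by norm_num)]; congr 1; ring
  rw [h2, ← h1, numberWave, numberWave, eval_herm, eval_herm, Polynomial.eval_mul]
  field_simp

theorem integrable_numberWave_mul (m n : ℕ) :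
    MeasureTheory.Integrable fun x => numberWave m x * numberWave n x := by
  simp only [numberWave_mul]
  exact ((integrable_poly (herm m * herm n)).comp_mul_left' (by positivity)).const_mul _

theorem integral_numberWave_mul (m n : ℕ) :
    ∫ x, numberWave m x * numberWave n x = if m = n then 1 else 0 := by
  simp only [numberWave_mul]
  rw [MeasureTheory.integral_const_mul, MeasureTheory.Measure.integral_comp_mul_left
    (fun y => (herm m * herm n).eval y * Real.exp (-(y ^ 2) / 2))]
  rcases lt_trichotomy m n with h | rfl | h
  · rw [integral_herm_herm_of_lt h, if_neg h.ne]; simp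
  · rw [integral_herm_self, if_pos rfl, Real.sqrt_mul (by norm_num), Real.mul_self_sqrt
      (by positivity), abs_of_pos (by positivity), smul_eq_mul]
    have : (m.factorial : ℝ) ≠ 0 := by positivity
    field_simp
  · rw [mul_comm (herm m), integral_herm_herm_of_lt h, if_neg h.ne']; simp

/-- The two-qumode number wavefunction. -/
def numberWave₂ (n : Fin 2 → ℕ) (q : Fin 2 → ℝ) : ℂ := ((∏ i, numberWave (n i) (q i) : ℝ) : ℂ)

theorem numberWave₂_mul (m n : Fin 2 → ℕ) (q : Fin 2 → ℝ) :
    numberWave₂ m q * numberWave₂ n q =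
      ((∏ i, (numberWave (m i) (q i) * numberWave (n i) (q i)) : ℝ) : ℂ) := by
  rw [numberWave₂, numberWave₂, Finset.prod_mul_distrib]
  push_cast
  rfl

theorem integral_numberWave₂_mul (m n : Fin 2 → ℕ) :
    ∫ q, numberWave₂ m q * numberWave₂ n q = if m = n then 1 else 0 := by
  simp only [numberWave₂_mul]
  rw [integral_complex_ofReal, MeasureTheory.integral_fintype_prod_volume_eq_prod
    (f := fun i x => numberWave (m i) x * numberWave (n i) x)]
  simp only [integral_numberWave_mul, Fin.prod_univ_two, funext_iff, Fin.forall_fin_two]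
  split_ifs <;> simp_all

theorem continuous_numberWave (n : ℕ) : Continuous (numberWave n) := by
  unfold numberWave
  simp only [eval_herm]
  fun_prop

theorem continuous_numberWave₂ (n : Fin 2 → ℕ) : Continuous (numberWave₂ n) := by
  have := continuous_numberWave
  unfold numberWave₂
  fun_prop

theorem memLp_numberWave₂ (n : Fin 2 → ℕ) : MeasureTheory.MemLp (numberWave₂ n) 2 := by
  rw [MeasureTheory.memLp_two_iff_integrable_sq_norm
    (continuous_numberWave₂ n).aestronglyMeasurable]
  have h : MeasureTheory.Integrable fun q : Fin 2 → ℝ =>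
      ∏ i, (numberWave (n i) (q i) * numberWave (n i) (q i)) :=
    MeasureTheory.Integrable.fintype_prod (f := fun i x => numberWave (n i) x * numberWave (n i) x)
      fun i => integrable_numberWave_mul _ _
  refine h.congr (Filter.Eventually.of_forall fun q => ?_)
  simp only [numberWave₂, Complex.norm_real, Real.norm_eq_abs, sq_abs]
  rw [Finset.prod_mul_distrib, sq]

theorem orthonormal_numberWave₂ :
    Orthonormal ℂ fun n : Fin 2 → ℕ => (memLp_numberWave₂ n).toLp (numberWave₂ n) := by
  rw [orthonormal_iff_ite]
  intro m n
  rw [MeasureTheory.L2.inner_def, ← integral_numberWave₂_mul]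
  refine MeasureTheory.integral_congr_ae ?_
  filter_upwards [(memLp_numberWave₂ m).coeFn_toLp, (memLp_numberWave₂ n).coeFn_toLp]
    with q h1 h2
  rw [h1, h2, RCLike.inner_apply, mul_comm]
  simp [numberWave₂]

theorem memℓp_numberAmplitudes {ψ : (Fin 2 → ℝ) → ℂ} (hψ : MeasureTheory.MemLp ψ 2) :
    Memℓp (numberAmplitudes ψ) 2 := by
  rw [memℓp_gen_iff (by norm_num)]
  have h := (orthonormal_numberWave₂).inner_products_summable (x := hψ.toLp ψ)
  norm_num
  refine h.congr fun n => ?_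
  congr 2
  rw [MeasureTheory.L2.inner_def, numberAmplitudes]
  refine MeasureTheory.integral_congr_ae ?_
  filter_upwards [(memLp_numberWave₂ n).coeFn_toLp, hψ.coeFn_toLp] with q h1 h2
  rw [h1, h2, RCLike.inner_apply, mul_comm]
  simp [numberWave₂]

theorem norm_gaussianWave_sq (Z : Matrix (Fin 2) (Fin 2) ℂ) (q : Fin 2 → ℝ) :
    ‖gaussianWave Z q‖ ^ 2 =
      ((Z.map Complex.im).det ^ (1 / 4 : ℝ) / Real.pi ^ (2 / 4 : ℝ)) ^ 2 *
      Real.exp (-∑ i, ∑ j, q i * (Z i j).im * q j) := by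
  rw [gaussianWave, norm_mul, Complex.norm_real, mul_pow, Real.norm_eq_abs, sq_abs,
    Complex.norm_exp, ← Real.exp_nat_mul]
  congr 2
  simp [Fin.sum_univ_two]

theorem memLp_gaussianWave {Z : Matrix (Fin 2) (Fin 2) ℂ} (hZ : IsGaussianGraph Z) :
    MeasureTheory.MemLp (gaussianWave Z) 2 := by
  have hc : Continuous (gaussianWave Z) := by unfold gaussianWave; fun_prop
  rw [MeasureTheory.memLp_two_iff_integrable_sq_norm hc.aestronglyMeasurable]
  have hdet := hZ.posDef.det_pos
  rw [Matrix.det_fin_two] at hdet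
  have h0 : 0 < (Z 0 0).im := hZ.posDef.diag_pos (i := 0)
  have h1 : 0 < (Z 1 1).im := hZ.posDef.diag_pos (i := 1)
  have hs : Z 1 0 = Z 0 1 := hZ.symm.apply 0 1
  simp only [Matrix.map_apply, hs] at hdet
  obtain ⟨u, hu⟩ : ∃ u, u = (Z 0 0).im := ⟨_, rfl⟩
  obtain ⟨v, hv⟩ : ∃ v, v = (Z 0 1).im := ⟨_, rfl⟩
  obtain ⟨w, hw⟩ : ∃ w, w = (Z 1 1).im := ⟨_, rfl⟩
  rw [← hu, ← hv, ← hw] at hdet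
  rw [← hu] at h0
  rw [← hw] at h1
  set κ : ℝ := (u * w - v * v) / (u + w) with hκ
  have hκ0 : 0 < κ := by positivity
  have hκu : κ * (u + w) = u * w - v * v := by rw [hκ]; field_simp
  have hlow (x y : ℝ) : κ * (x ^ 2 + y ^ 2) ≤ u * x ^ 2 + 2 * v * (x * y) + w * y ^ 2 := by
    have hu' : 0 < u - κ := by
      rw [hκ, sub_pos, div_lt_iff₀ (by positivity)]; nlinarith [sq_nonneg v, mul_pos h0 h0]
    have e : (u - κ) * (u * x ^ 2 + 2 * v * (x * y) + w * y ^ 2 - κ * (x ^ 2 + y ^ 2)) =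
        ((u - κ) * x + v * y) ^ 2 + (u * w - v * v - κ * (u + w) + κ ^ 2) * y ^ 2 := by ring
    have e2 : 0 ≤ (u - κ) *
        (u * x ^ 2 + 2 * v * (x * y) + w * y ^ 2 - κ * (x ^ 2 + y ^ 2)) := by
      rw [e, hκu]; nlinarith [sq_nonneg ((u - κ) * x + v * y), sq_nonneg (κ * y)]
    have := nonneg_of_mul_nonneg_right e2 hu'
    linarith
  have hg : MeasureTheory.Integrable fun q : Fin 2 → ℝ => ∏ i, Real.exp (-κ * (q i) ^ 2) :=
    MeasureTheory.Integrable.fintype_prod (f := fun _ x => Real.exp (-κ * x ^ 2))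
      fun _ => integrable_exp_neg_mul_sq hκ0
  refine (hg.const_mul
    (((Z.map Complex.im).det ^ (1 / 4 : ℝ) / Real.pi ^ (2 / 4 : ℝ)) ^ 2)).mono'
    (by fun_prop) (Filter.Eventually.of_forall fun q => ?_)
  rw [Real.norm_of_nonneg (by positivity), norm_gaussianWave_sq, ← Real.exp_sum]
  refine mul_le_mul_of_nonneg_left (Real.exp_le_exp.2 ?_) (by positivity)
  simp only [Fin.sum_univ_two, hs, ← hu, ← hv, ← hw]
  have := hlow (q 0) (q 1)
  linarith

/-- The Gaussian pure state `|ψ_Z⟩`: the wavefunction `ψ_Z` expanded in the number basis. -/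
def gaussianState (Z : Matrix (Fin 2) (Fin 2) ℂ) (hZ : IsGaussianGraph Z) : FockSpace :=
  ⟨numberAmplitudes (gaussianWave Z), memℓp_numberAmplitudes (memLp_gaussianWave hZ)⟩

/-- The adjacency matrix `K = (I + i Z) (I - i Z)⁻¹`. -/
def adjacency (Z : Matrix (Fin 2) (Fin 2) ℂ) : Matrix (Fin 2) (Fin 2) ℂ :=
  (1 + Complex.I • Z) * (1 - Complex.I • Z)⁻¹

/-- The three linear constraints on `K = [[k11, k12], [k12, k22]]`. -/
def Constraints (α β γ δ : ℝ) (K : Matrix (Fin 2) (Fin 2) ℂ) : Prop :=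
  ((α : ℂ) + δ) * K 0 0 + (β - Complex.I * γ) * K 0 1 = 0 ∧
  (β + Complex.I * γ) * K 0 1 + ((α : ℂ) - δ) * K 1 1 = 0 ∧
  2 * (α : ℂ) * K 0 1 + (β - Complex.I * γ) * K 1 1 + (β + Complex.I * γ) * K 0 0 = 0

end Qumodes

end

/-!
The Hamiltonian `α S⁰ + β Sˣ + γ Sʸ + δ Sᶻ` is the second quantization `∑ h i j a_i† a_j` of a
Hermitian `2 × 2` matrix `h` with eigenvalues `(α ± r) / 2`. A Gaussian state obeys
`a_i ψ = ∑ K i j a_j† ψ`, so the Hamiltonian sends it to a quadratic form in the `a_i†` with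
coefficient matrix `(h K + K hᵀ) / 2`, whose entries are the constraints; they therefore make `ψ` a
null vector of the Hamiltonian and a fixed vector of every `U(θ)`. Conversely, the two-photon
component of `ψ`, read as a symmetric tensor, is a nonzero multiple of `K`, and on such tensors the
Hamiltonian acts by `M ↦ h M + M hᵀ`, with eigenvalues `α` and `α ± r`. If no phase `exp (-i λ)` of
a nonzero eigenvalue equals `1`, a vector fixed by `U` is a null vector, which gives
`h K + K hᵀ = 0`; if `ψ` is fixed by all `U(θ)`, differentiating at `θ = 0` gives the same without
restriction.
-/

noncomputable section

namespace Qumodes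

theorem annih_apply (i : Fin 2) (c : Amplitudes) (n : Fin 2 → ℕ) :
    annih i c n = (Real.sqrt ((n i : ℝ) + 1) : ℂ) * c (n + Pi.single i 1) := rfl

theorem create_apply (i : Fin 2) (c : Amplitudes) (n : Fin 2 → ℕ) :
    create i c n = (Real.sqrt (n i : ℝ) : ℂ) * c (n - Pi.single i 1) := rfl

theorem create_apply_zero (i : Fin 2) (c : Amplitudes) : create i c 0 = 0 := by
  simp [create_apply]

theorem commute_annih (i j : Fin 2) : Commute (annih i) (annih j) := by
  refine LinearMap.ext fun c => funext fun n => ?_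
  rcases eq_or_ne i j with rfl | h
  · rfl
  · simp only [Module.End.mul_apply, annih_apply, Pi.add_apply, Pi.single_eq_of_ne h,
      Pi.single_eq_of_ne h.symm, add_zero, add_right_comm]
    ring

theorem commute_create (i j : Fin 2) : Commute (create i) (create j) := by
  refine LinearMap.ext fun c => funext fun n => ?_
  rcases eq_or_ne i j with rfl | h
  · rfl
  · simp only [Module.End.mul_apply, create_apply, Pi.sub_apply, Pi.single_eq_of_ne h,
      Pi.single_eq_of_ne h.symm, Nat.sub_zero, tsub_right_comm]
    ring

theorem ofReal_sqrt_mul_self {x : ℝ} (hx : 0 ≤ x) :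
    (Real.sqrt x : ℂ) * (Real.sqrt x : ℂ) = x := by
  exact_mod_cast Real.mul_self_sqrt hx

theorem annih_create_self (i : Fin 2) (c : Amplitudes) :
    annih i (create i c) = create i (annih i c) + c := by
  funext n
  have hr := ofReal_sqrt_mul_self (x := (n i : ℝ) + 1) (by positivity)
  have hl := ofReal_sqrt_mul_self (x := (n i : ℝ)) (by positivity)
  rw [Pi.add_apply, annih_apply, create_apply, create_apply, annih_apply, add_tsub_cancel_right]
  rcases Nat.eq_zero_or_pos (n i) with h | h
  · simp [h]
  · have hn : n - Pi.single i 1 + Pi.single i 1 = n :=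
      tsub_add_cancel_of_le (update_le_iff.2 ⟨h, fun k _ => Nat.zero_le _⟩)
    have hi : (((n - Pi.single i 1 : Fin 2 → ℕ) i : ℕ) : ℝ) + 1 = n i := by
      rw [Pi.sub_apply, Pi.single_eq_same, Nat.cast_sub h]; simp
    rw [hn, hi, Pi.add_apply, Pi.single_eq_same, Nat.cast_add, Nat.cast_one]
    push_cast at hr hl
    linear_combination c n * hr - c n * hl

theorem annih_create_of_ne {i j : Fin 2} (h : i ≠ j) (c : Amplitudes) :
    annih i (create j c) = create j (annih i c) := by
  funext n
  have hij : n + Pi.single i 1 - Pi.single j 1 = n - Pi.single j 1 + Pi.single i 1 := by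
    funext k
    rcases eq_or_ne k i with rfl | hk <;> simp [*]
  simp only [annih_apply, create_apply, Pi.add_apply, Pi.sub_apply, Pi.single_eq_of_ne h,
    Pi.single_eq_of_ne h.symm, add_zero, Nat.sub_zero, hij]
  ring

theorem annih_create (i j : Fin 2) (c : Amplitudes) :
    annih i (create j c) = create j (annih i c) + (1 : Matrix (Fin 2) (Fin 2) ℂ) i j • c := by
  rcases eq_or_ne i j with rfl | h
  · rw [annih_create_self, Matrix.one_apply_eq, one_smul]
  · rw [annih_create_of_ne h, Matrix.one_apply_ne h, zero_smul, add_zero]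

/-- The Hamiltonian of a single photon: `generator α β γ δ` is its second quantization
`∑ i j, h i j a_i† a_j`. -/
def photonMatrix (α β γ δ : ℝ) : Matrix (Fin 2) (Fin 2) ℂ :=
  (1 / 2 : ℂ) • !![(α : ℂ) + δ, β - Complex.I * γ; β + Complex.I * γ, (α : ℂ) - δ]

theorem generator_apply (α β γ δ : ℝ) (c : Amplitudes) :
    generator α β γ δ c = ∑ i, ∑ j, photonMatrix α β γ δ i j • create i (annih j c) := by
  have hI : (1 : ℂ) / (2 * Complex.I) = -Complex.I / 2 := by
    field_simp; simp
  simp only [generator, S0, Sx, Sy, Sz, hI, LinearMap.add_apply, LinearMap.smul_apply,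
    LinearMap.sub_apply, Module.End.mul_apply, photonMatrix, Fin.sum_univ_two, Matrix.smul_apply,
    Matrix.of_apply, Matrix.cons_val', Matrix.cons_val_zero, Matrix.cons_val_one,
    Matrix.cons_val_fin_one, smul_eq_mul]
  module

theorem generator_apply_zero (α β γ δ : ℝ) (c : Amplitudes) : generator α β γ δ c 0 = 0 := by
  simp [generator_apply, create_apply_zero]

theorem annih_generator (α β γ δ : ℝ) (i : Fin 2) (c : Amplitudes) :
    annih i (generator α β γ δ c) =
      generator α β γ δ (annih i c) + ∑ j, photonMatrix α β γ δ i j • annih j c := by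
  have hcomm (j : Fin 2) : annih i (annih j c) = annih j (annih i c) :=
    LinearMap.congr_fun (commute_annih i j) c
  simp only [generator_apply, map_sum, map_smul, annih_create, hcomm, smul_add, smul_smul,
    Finset.sum_add_distrib]
  congr 1
  rw [Finset.sum_comm]
  simp only [← Finset.sum_smul, Matrix.one_apply, mul_ite, mul_one, mul_zero, Finset.sum_ite_eq,
    Finset.mem_univ, if_true]

theorem generator_smul (t α β γ δ : ℝ) :
    generator (t * α) (t * β) (t * γ) (t * δ) = (t : ℂ) • generator α β γ δ := by
  simp only [generator, Complex.ofReal_mul]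
  module

/-- The two-photon component of `c` as a symmetric tensor, `⟨0| a_i a_j |c⟩`. -/
def twoPhoton : Amplitudes →ₗ[ℂ] Matrix (Fin 2) (Fin 2) ℂ where
  toFun c := Matrix.of fun i j => annih i (annih j c) 0
  map_add' c d := by ext i j; simp
  map_smul' r c := by ext i j; simp

theorem twoPhoton_apply (c : Amplitudes) (i j : Fin 2) :
    twoPhoton c i j = annih i (annih j c) 0 := rfl

theorem isSymm_twoPhoton (c : Amplitudes) : (twoPhoton c).IsSymm :=
  Matrix.IsSymm.ext fun i j =>
    congrFun (LinearMap.congr_fun (commute_annih j i) c) 0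

theorem twoPhoton_generator (α β γ δ : ℝ) (c : Amplitudes) :
    twoPhoton (generator α β γ δ c) =
      photonMatrix α β γ δ * twoPhoton c + twoPhoton c * (photonMatrix α β γ δ).transpose := by
  ext i j
  simp only [twoPhoton_apply, annih_generator, map_add, map_sum, map_smul, Pi.add_apply,
    generator_apply_zero, zero_add, Finset.sum_apply, Pi.smul_apply, smul_eq_mul, Matrix.add_apply,
    Matrix.mul_apply, Matrix.transpose_apply, mul_comm]

theorem res_eq_zero_iff {m : ℕ} {c : Amplitudes} :
    res m c = 0 ↔ ∀ n : Fin 2 → ℕ, n 0 + n 1 = m → c n = 0 := by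
  refine ⟨fun h n hn => ?_, fun h => PiLp.ext fun p => h _ ?_⟩
  · have hlab : lab (n 0, n 1) = n := by funext i; fin_cases i <;> rfl
    rw [← hlab]
    exact congrFun (congrArg WithLp.ofLp h) ⟨(n 0, n 1), by simpa using hn⟩
  · exact Finset.HasAntidiagonal.mem_antidiagonal.1 p.2

theorem exists_eq_single_add_single {n : Fin 2 → ℕ} (hn : n 0 + n 1 = 2) :
    ∃ i j, n = Pi.single i 1 + Pi.single j 1 := by
  obtain ⟨h0, h1⟩ | ⟨h0, h1⟩ | ⟨h0, h1⟩ :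
    (n 0 = 2 ∧ n 1 = 0) ∨ (n 0 = 1 ∧ n 1 = 1) ∨ (n 0 = 0 ∧ n 1 = 2) := by omega
  · exact ⟨0, 0, by funext k; fin_cases k <;> simp [h0, h1]⟩
  · exact ⟨0, 1, by funext k; fin_cases k <;> simp [h0, h1]⟩
  · exact ⟨1, 1, by funext k; fin_cases k <;> simp [h0, h1]⟩

theorem twoPhoton_apply_eq_zero_iff {c : Amplitudes} {i j : Fin 2} :
    twoPhoton c i j = 0 ↔ c (Pi.single i 1 + Pi.single j 1) = 0 := by
  have hsqrt (k : ℕ) : (Real.sqrt ((k : ℝ) + 1) : ℂ) ≠ 0 :=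
    Complex.ofReal_ne_zero.2 (Real.sqrt_pos.2 (by positivity)).ne'
  rw [twoPhoton_apply, annih_apply, annih_apply, zero_add, mul_eq_zero_iff_left (hsqrt _),
    mul_eq_zero_iff_left (hsqrt _)]

theorem twoPhoton_eq_zero_iff {c : Amplitudes} : twoPhoton c = 0 ↔ res 2 c = 0 := by
  rw [res_eq_zero_iff]
  refine ⟨fun h n hn => ?_, fun h => ?_⟩
  · obtain ⟨i, j, rfl⟩ := exists_eq_single_add_single hn
    exact twoPhoton_apply_eq_zero_iff.1 (by rw [h, Matrix.zero_apply])
  · ext i j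
    refine twoPhoton_apply_eq_zero_iff.2 (h _ ?_)
    fin_cases i <;> fin_cases j <;> simp

end Qumodes

theorem eq_zero_or_sq_eq_of_mul_add_mul_eq_smul {𝕜 R : Type*} [Field 𝕜] [Ring R] [Algebra 𝕜 R]
    {A B M : R} {s m : 𝕜} (hA : A * A = s • 1) (hB : B * B = s • 1) (hM : M ≠ 0)
    (h : A * M + M * B = m • M) : m = 0 ∨ m ^ 2 = 4 * s := by
  have hAM : A * (A * M + M * B) = s • M + A * M * B := by
    rw [mul_add, ← mul_assoc, hA, smul_one_mul, mul_assoc]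
  have hMB : (A * M + M * B) * B = A * M * B + s • M := by
    rw [add_mul, mul_assoc M, hB, mul_smul_one]
  have hAMB : m • (A * M * B) = s • m • M := by
    calc m • (A * M * B) = A * (m • M) * B := by rw [mul_smul_comm, smul_mul_assoc]
      _ = A * (A * M + M * B) * B := by rw [h]
      _ = s • (A * M + M * B) := by
        rw [hAM, add_mul, mul_assoc _ B, hB, mul_smul_one, smul_mul_assoc, add_comm, smul_add]
      _ = s • m • M := by rw [h]
  have hcube : m ^ 3 • M = (4 * s * m) • M := by
    have hsq : m ^ 2 • M = (2 * s) • M + (2 : 𝕜) • (A * M * B) := by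
      calc m ^ 2 • M = A * (m • M) + (m • M) * B := by
            rw [mul_smul_comm, smul_mul_assoc, ← smul_add, h, smul_smul, sq]
        _ = (2 * s) • M + (2 : 𝕜) • (A * M * B) := by rw [← h, hAM, hMB]; module
    calc m ^ 3 • M = m • m ^ 2 • M := by rw [smul_smul, ← pow_succ']
      _ = (2 * s * m) • M + (2 : 𝕜) • m • (A * M * B) := by rw [hsq]; module
      _ = (4 * s * m) • M := by rw [hAMB]; module
  have hm : m * (m ^ 2 - 4 * s) = 0 := by
    linear_combination smul_left_injective 𝕜 hM hcube
  exact (mul_eq_zero.1 hm).imp_right sub_eq_zero.1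

namespace Qumodes

theorem photonMatrix_sub_mul_self (α β γ δ : ℝ) :
    (photonMatrix α β γ δ - (α / 2 : ℂ) • 1) * (photonMatrix α β γ δ - (α / 2 : ℂ) • 1) =
      (((β ^ 2 + γ ^ 2 + δ ^ 2) / 4 : ℝ) : ℂ) • 1 := by
  have htraceless : photonMatrix α β γ δ - (α / 2 : ℂ) • 1 =
      (1 / 2 : ℂ) • !![(δ : ℂ), β - Complex.I * γ; β + Complex.I * γ, -δ] := by
    ext i j
    fin_cases i <;> fin_cases j <;> simp [photonMatrix] <;> ring
  rw [htraceless, smul_mul_smul_comm, Matrix.mul_fin_two]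
  ext i j
  fin_cases i <;> fin_cases j <;> simp <;> grind [Complex.I_sq]

theorem eigenvalue_secGen_two {α β γ δ l : ℝ}
    (h : Module.End.HasEigenvalue (secGen 2 α β γ δ).toLinearMap (l : ℂ)) :
    l = α ∨ l = α + Real.sqrt (β ^ 2 + γ ^ 2 + δ ^ 2) ∨
      l = α - Real.sqrt (β ^ 2 + γ ^ 2 + δ ^ 2) := by
  obtain ⟨w, hw⟩ := h.exists_hasEigenvector
  have hgen : twoPhoton (generator α β γ δ (ext 2 w)) = (l : ℂ) • twoPhoton (ext 2 w) := by
    rw [← sub_eq_zero, ← map_smul, ← map_sub, twoPhoton_eq_zero_iff, map_sub, map_smul,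
      res_generator, res_ext, sub_eq_zero]
    exact hw.apply_eq_smul
  have hne : twoPhoton (ext 2 w) ≠ 0 := by
    rw [Ne, twoPhoton_eq_zero_iff, res_ext]
    exact hw.2
  rw [twoPhoton_generator] at hgen
  set A := photonMatrix α β γ δ - (α / 2 : ℂ) • 1 with hA
  have hAA : A * A = _ := photonMatrix_sub_mul_self α β γ δ
  have hBB : A.transpose * A.transpose = (((β ^ 2 + γ ^ 2 + δ ^ 2) / 4 : ℝ) : ℂ) • 1 := by
    rw [← Matrix.transpose_mul, hAA, Matrix.transpose_smul, Matrix.transpose_one]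
  have hM : A * twoPhoton (ext 2 w) + twoPhoton (ext 2 w) * A.transpose =
      ((l - α : ℝ) : ℂ) • twoPhoton (ext 2 w) := by
    rw [hA, Matrix.transpose_sub, Matrix.transpose_smul, Matrix.transpose_one, sub_mul, mul_sub,
      smul_one_mul, mul_smul_one, Complex.ofReal_sub, sub_smul, ← hgen]
    module
  rcases eq_zero_or_sq_eq_of_mul_add_mul_eq_smul hAA hBB hne hM with h | h
  · exact Or.inl (sub_eq_zero.1 (Complex.ofReal_eq_zero.1 h))
  · have hsq : (l - α) ^ 2 = Real.sqrt (β ^ 2 + γ ^ 2 + δ ^ 2) ^ 2 := by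
      rw [Real.sq_sqrt (by positivity)]
      have h' : (l - α) ^ 2 = 4 * ((β ^ 2 + γ ^ 2 + δ ^ 2) / 4) := by exact_mod_cast h
      linarith
    exact Or.inr ((sq_eq_sq_iff_eq_or_eq_neg.1 hsq).imp (fun h => by linarith)
      fun h => by linarith)

/-- `c` obeys the nullifier relations `a_i c = ∑ j, K i j a_j† c`, which characterize a Gaussian
state with adjacency matrix `K` up to a scalar. -/
def IsNullified (K : Matrix (Fin 2) (Fin 2) ℂ) (c : Amplitudes) : Prop :=
  ∀ i, annih i c = ∑ j, K i j • create j c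

namespace IsNullified

variable {K : Matrix (Fin 2) (Fin 2) ℂ} {c : Amplitudes}

theorem twoPhoton_eq (hc : IsNullified K c) : twoPhoton c = c 0 • K := by
  rw [← (isSymm_twoPhoton c).eq]
  ext i j
  simp only [Matrix.transpose_apply, twoPhoton_apply, hc i, map_sum, map_smul, annih_create,
    Finset.sum_apply, Pi.smul_apply, Pi.add_apply, create_apply_zero, zero_add, smul_eq_mul,
    Matrix.smul_apply]
  simp [Matrix.one_apply, mul_comm]

theorem isSymm (hc : IsNullified K c) (h0 : c 0 ≠ 0) : K.IsSymm := by
  rw [← inv_smul_smul₀ h0 K, ← hc.twoPhoton_eq]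
  exact (isSymm_twoPhoton c).smul _

theorem generator_eq_sum (hc : IsNullified K c) (α β γ δ : ℝ) :
    (2 : ℂ) • generator α β γ δ c = ∑ i, ∑ j,
      (photonMatrix α β γ δ * K + (photonMatrix α β γ δ * K).transpose) i j •
        create i (create j c) := by
  have hcomm (i j : Fin 2) : create i (create j c) = create j (create i c) :=
    LinearMap.congr_fun (commute_create i j) c
  have h : generator α β γ δ c =
      ∑ i, ∑ j, (photonMatrix α β γ δ * K) i j • create i (create j c) := by
    simp only [generator_apply, hc _, map_sum, map_smul, Finset.smul_sum, smul_smul,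
      Matrix.mul_apply, Finset.sum_smul]
    exact Finset.sum_congr rfl fun i _ => Finset.sum_comm
  have h' : generator α β γ δ c =
      ∑ i, ∑ j, (photonMatrix α β γ δ * K).transpose i j • create i (create j c) := by
    rw [h, Finset.sum_comm]
    simp only [Matrix.transpose_apply, hcomm]
  simp only [Matrix.add_apply, add_smul, Finset.sum_add_distrib, ← h, ← h', two_smul]

end IsNullified

theorem constraints_iff_photonMatrix {α β γ δ : ℝ} {K : Matrix (Fin 2) (Fin 2) ℂ}
    (hK : K.IsSymm) : Constraints α β γ δ K ↔
      photonMatrix α β γ δ * K + K * (photonMatrix α β γ δ).transpose = 0 := by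
  have hs : K 1 0 = K 0 1 := hK.apply 0 1
  have hmul : photonMatrix α β γ δ * K + K * (photonMatrix α β γ δ).transpose =
      !![((α : ℂ) + δ) * K 0 0 + (β - Complex.I * γ) * K 0 1,
        (2 * (α : ℂ) * K 0 1 + (β - Complex.I * γ) * K 1 1 + (β + Complex.I * γ) * K 0 0) / 2;
        (2 * (α : ℂ) * K 0 1 + (β - Complex.I * γ) * K 1 1 + (β + Complex.I * γ) * K 0 0) / 2,
        (β + Complex.I * γ) * K 0 1 + ((α : ℂ) - δ) * K 1 1] := by
    ext i j
    fin_cases i <;> fin_cases j <;>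
      simp [Matrix.mul_apply, Matrix.vecMul, dotProduct, Fin.sum_univ_two, photonMatrix, hs] <;>
      ring
  rw [hmul, ← Matrix.ext_iff, Constraints]
  simp only [Fin.forall_fin_two, Matrix.of_apply, Matrix.cons_val', Matrix.cons_val_fin_one,
    Matrix.cons_val_zero, Matrix.cons_val_one, Matrix.zero_apply, div_eq_zero_iff,
    OfNat.ofNat_ne_zero, or_false]
  tauto

namespace IsNullified

variable {K : Matrix (Fin 2) (Fin 2) ℂ} {c : Amplitudes}

theorem twoPhoton_generator_eq_zero_iff (hc : IsNullified K c) (h0 : c 0 ≠ 0) {α β γ δ : ℝ} :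
    twoPhoton (generator α β γ δ c) = 0 ↔ Constraints α β γ δ K := by
  rw [constraints_iff_photonMatrix (hc.isSymm h0), twoPhoton_generator, hc.twoPhoton_eq,
    mul_smul_comm, smul_mul_assoc, ← smul_add, smul_eq_zero_iff_right h0]

theorem generator_eq_zero_iff (hc : IsNullified K c) (h0 : c 0 ≠ 0) {α β γ δ : ℝ} :
    generator α β γ δ c = 0 ↔ Constraints α β γ δ K := by
  refine ⟨fun h => ?_, fun h => ?_⟩
  · rw [← hc.twoPhoton_generator_eq_zero_iff h0, h, map_zero]
  · rw [constraints_iff_photonMatrix (hc.isSymm h0)] at h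
    have hsum := hc.generator_eq_sum α β γ δ
    rw [Matrix.transpose_mul, (hc.isSymm h0).eq, h] at hsum
    simpa using hsum

end IsNullified

end Qumodes

theorem exp_apply_of_apply_eq_smul {𝕜 E : Type*} [RCLike 𝕜] [NormedAddCommGroup E]
    [NormedSpace 𝕜 E] [CompleteSpace E] {T : E →L[𝕜] E} {a : 𝕜} {v : E} (h : T v = a • v) :
    NormedSpace.exp T v = NormedSpace.exp a • v := by
  have hpow (k : ℕ) : (T ^ k) v = a ^ k • v := by
    induction k with
    | zero => simp
    | succ k ih => rw [pow_succ, mul_apply_eq_comp, h, map_smul, ih, smul_smul, pow_succ']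
  have hT := (NormedSpace.exp_series_hasSum_exp' (𝕂 := 𝕜) T).mapL (ContinuousLinearMap.apply 𝕜 E v)
  have ha := (NormedSpace.exp_series_hasSum_exp' (𝕂 := 𝕜) a).smul_const v
  refine hT.unique (ha.congr_fun fun k => ?_)
  simp [hpow, smul_smul]

theorem eq_zero_of_cexp_neg_I_mul_eq_one {x : ℝ} (hx : ∀ k : ℤ, k ≠ 0 → x ≠ 2 * Real.pi * k)
    (h : Complex.exp (-Complex.I * x) = 1) : x = 0 := by
  obtain ⟨k, hk⟩ := Complex.exp_eq_one_iff.1 h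
  have hxk : x = 2 * Real.pi * (-k : ℤ) := by
    have hxk' : (x : ℂ) = 2 * Real.pi * (-k : ℤ) := by
      refine mul_left_cancel₀ (neg_ne_zero.2 Complex.I_ne_zero) ?_
      rw [hk]; push_cast; ring
    exact_mod_cast hxk'
  by_contra hne
  refine hx (-k) (fun hk0 => hne ?_) hxk
  simp [hxk, hk0]

theorem apply_eq_zero_of_exp_apply_eq_self {E : Type*} [NormedAddCommGroup E]
    [InnerProductSpace ℂ E] [FiniteDimensional ℂ E] {T : E →L[ℂ] E}
    (hT : T.toLinearMap.IsSymmetric)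
    (hev : ∀ l : ℝ, Module.End.HasEigenvalue T.toLinearMap (l : ℂ) →
      ∀ k : ℤ, k ≠ 0 → l ≠ 2 * Real.pi * k)
    {v : E} (hv : NormedSpace.exp ((-Complex.I) • T) v = v) : T v = 0 := by
  have := FiniteDimensional.complete ℂ E
  let b := hT.eigenvectorBasis rfl
  let l := hT.eigenvalues rfl
  have hb (i) : T (b i) = (l i : ℂ) • b i := hT.apply_eigenvectorBasis rfl i
  have hexp (i) : NormedSpace.exp ((-Complex.I) • T) (b i) =
      Complex.exp (-Complex.I * l i) • b i := by
    rw [Complex.exp_eq_exp_ℂ]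
    refine exp_apply_of_apply_eq_smul ?_
    rw [smul_apply, hb, smul_smul]
  have hrepr (i) : Complex.exp (-Complex.I * l i) * b.repr v i = b.repr v i := by
    have hsum : ∑ i, (Complex.exp (-Complex.I * l i) * b.repr v i) • b i = v := by
      conv_rhs => rw [← hv, ← b.sum_repr v]
      simp only [map_sum, map_smul, hexp, smul_smul, mul_comm]
    have hinner := congrArg (fun u => inner ℂ (b i) u) hsum
    simpa only [b.orthonormal.inner_right_fintype, ← b.repr_apply_apply] using hinner
  rw [← b.sum_repr v, map_sum]
  refine Finset.sum_eq_zero fun i _ => ?_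
  rw [map_smul, hb, smul_smul]
  by_cases hr : b.repr v i = 0
  · rw [hr, zero_mul, zero_smul]
  · have hl : l i = 0 := eq_zero_of_cexp_neg_I_mul_eq_one
      (hev _ (hT.hasEigenvalue_eigenvalues rfl i)) ((mul_eq_right₀ hr).1 (hrepr i))
    rw [hl, Complex.ofReal_zero, mul_zero, zero_smul]

theorem apply_eq_zero_of_forall_exp_smul_apply_eq_self {E : Type*} [NormedAddCommGroup E]
    [NormedSpace ℂ E] [CompleteSpace E] {T : E →L[ℂ] E} {v : E}
    (h : ∀ t : ℝ, NormedSpace.exp ((t : ℂ) • T) v = v) : T v = 0 := by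
  have hderiv : HasDerivAt (fun u : ℂ => NormedSpace.exp (u • T) v) (T v) ((0 : ℝ) : ℂ) := by
    simpa using (hasDerivAt_exp_smul_const T ((0 : ℝ) : ℂ)).clm_apply (hasDerivAt_const _ v)
  have hreal := hderiv.scomp (0 : ℝ) Complex.ofRealCLM.hasDerivAt
  have hconst : HasDerivAt (fun t : ℝ => NormedSpace.exp ((t : ℂ) • T) v) 0 0 := by
    simpa only [h] using hasDerivAt_const (0 : ℝ) v
  simpa using hreal.unique hconst

namespace Qumodes

theorem evolve_eq_self_of_generator_eq_zero {α β γ δ : ℝ} {c : Amplitudes}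
    (h : generator α β γ δ c = 0) : evolve α β γ δ c = c := by
  refine evolve_ext fun m => ?_
  have hm : ((-Complex.I) • secGen m α β γ δ) (res m c) = (0 : ℂ) • res m c := by
    rw [smul_apply, ← res_generator, h, map_zero, smul_zero, zero_smul]
  rw [res_evolve, exp_apply_of_apply_eq_smul hm, NormedSpace.exp_zero, one_smul]

theorem secGen_smul (m : ℕ) (t α β γ δ : ℝ) :
    secGen m (t * α) (t * β) (t * γ) (t * δ) = (t : ℂ) • secGen m α β γ δ := by
  ext v : 1
  simp [secGen, generator_smul]

theorem forall_evolve_eq_self_iff {α β γ δ : ℝ} {c : Amplitudes} :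
    (∀ t : ℝ, evolve (t * α) (t * β) (t * γ) (t * δ) c = c) ↔ generator α β γ δ c = 0 := by
  refine ⟨fun h => evolve_ext fun m => ?_, fun h t => evolve_eq_self_of_generator_eq_zero ?_⟩
  · have hexp (t : ℝ) : NormedSpace.exp ((t : ℂ) • (-Complex.I) • secGen m α β γ δ) (res m c) =
        res m c := by
      rw [smul_comm, ← secGen_smul, ← res_evolve, h t]
    rw [res_generator, map_zero, ← smul_eq_zero_iff_right (neg_ne_zero.2 Complex.I_ne_zero)]
    exact apply_eq_zero_of_forall_exp_smul_apply_eq_self hexp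
  · rw [generator_smul, LinearMap.smul_apply, h, smul_zero]

theorem IsNullified.constraints_of_evolve_eq_self {α β γ δ : ℝ} {K : Matrix (Fin 2) (Fin 2) ℂ}
    {c : Amplitudes} (hc : IsNullified K c) (h0 : c 0 ≠ 0)
    (hr : ∀ k : ℤ, k ≠ 0 → α ≠ 2 * Real.pi * k ∧
      α + Real.sqrt (β ^ 2 + γ ^ 2 + δ ^ 2) ≠ 2 * Real.pi * k ∧
      α - Real.sqrt (β ^ 2 + γ ^ 2 + δ ^ 2) ≠ 2 * Real.pi * k)
    (h : evolve α β γ δ c = c) : Constraints α β γ δ K := by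
  rw [← hc.twoPhoton_generator_eq_zero_iff h0, twoPhoton_eq_zero_iff, res_generator]
  refine apply_eq_zero_of_exp_apply_eq_self
    (ContinuousLinearMap.isSelfAdjoint_iff_isSymmetric.1 (secGen_isSelfAdjoint 2 α β γ δ))
    (fun l hl k hk => ?_) (by rw [← res_evolve, h])
  rcases eigenvalue_secGen_two hl with rfl | rfl | rfl
  exacts [(hr k hk).1, (hr k hk).2.1, (hr k hk).2.2]

open Polynomial in
theorem derivative_herm_succ (n : ℕ) :
    derivative (herm (n + 1)) = ((n : ℝ[X]) + 1) * herm n := by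
  induction n with
  | zero => simp [herm]
  | succ n ih =>
    rw [herm_succ (n + 1), derivative_sub, derivative_mul, derivative_X, ih, derivative_mul,
      derivative_add, derivative_natCast, derivative_one, add_zero, herm_succ n]
    push_cast
    ring

theorem numberWave_eq (n : ℕ) (x : ℝ) :
    numberWave n x = (herm n).eval (Real.sqrt 2 * x) * Real.exp (-(x ^ 2) / 2) /
      (Real.pi ^ (1 / 4 : ℝ) * Real.sqrt (n.factorial : ℝ)) := by
  rw [numberWave, eval_herm]

theorem sqrt_factorial_succ (n : ℕ) :
    Real.sqrt ((n + 1).factorial : ℝ) =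
      Real.sqrt ((n : ℝ) + 1) * Real.sqrt (n.factorial : ℝ) := by
  rw [Nat.factorial_succ, Nat.cast_mul, Real.sqrt_mul (by positivity), Nat.cast_succ]

theorem sqrt_mul_numberWave_succ (n : ℕ) (x : ℝ) :
    Real.sqrt ((n : ℝ) + 1) * numberWave (n + 1) x =
      (herm (n + 1)).eval (Real.sqrt 2 * x) * Real.exp (-(x ^ 2) / 2) /
        (Real.pi ^ (1 / 4 : ℝ) * Real.sqrt (n.factorial : ℝ)) := by
  have hn : Real.sqrt ((n : ℝ) + 1) ≠ 0 := by positivity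
  rw [numberWave_eq, sqrt_factorial_succ]
  field_simp

theorem sqrt_two_mul_numberWave (n : ℕ) (x : ℝ) :
    Real.sqrt 2 * x * numberWave n x =
      Real.sqrt ((n : ℝ) + 1) * numberWave (n + 1) x +
        Real.sqrt (n : ℝ) * numberWave (n - 1) x := by
  rw [sqrt_mul_numberWave_succ]
  cases n with
  | zero => simp [numberWave_eq, herm]; ring
  | succ n =>
    have hn : Real.sqrt ((n : ℝ) + 1) ≠ 0 := by positivity
    have hsq : Real.sqrt ((n : ℝ) + 1) ^ 2 = n + 1 := Real.sq_sqrt (by positivity)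
    rw [herm_succ (n + 1), derivative_herm_succ, numberWave_eq, numberWave_eq, sqrt_factorial_succ,
      Nat.add_sub_cancel, Nat.cast_succ]
    simp only [Polynomial.eval_sub, Polynomial.eval_mul, Polynomial.eval_X, Polynomial.eval_add,
      Polynomial.eval_one, Polynomial.eval_natCast]
    field_simp
    rw [hsq]
    ring

theorem hasDerivAt_numberWave (n : ℕ) (x : ℝ) :
    HasDerivAt (numberWave n)
      (x * numberWave n x - Real.sqrt 2 * (Real.sqrt ((n : ℝ) + 1) * numberWave (n + 1) x)) x := by
  have hherm : HasDerivAt (fun x : ℝ => (herm n).eval (Real.sqrt 2 * x))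
      ((Polynomial.derivative (herm n)).eval (Real.sqrt 2 * x) * (Real.sqrt 2 * 1)) x :=
    ((herm n).hasDerivAt (Real.sqrt 2 * x)).comp x ((hasDerivAt_id x).const_mul _)
  have hexponent : HasDerivAt (fun x : ℝ => -(x ^ 2) / 2) (-x) x := by
    refine ((hasDerivAt_pow 2 x).fun_neg.div_const 2).congr_deriv ?_
    norm_num
    ring
  have hsq : Real.sqrt 2 ^ 2 = 2 := Real.sq_sqrt (by positivity)
  rw [sqrt_mul_numberWave_succ, herm_succ, funext (numberWave_eq n)]
  refine ((hherm.mul hexponent.exp).div_const _).congr_deriv ?_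
  simp only [Polynomial.eval_sub, Polynomial.eval_mul, Polynomial.eval_X]
  field_simp
  linear_combination (x * (herm n).eval (Real.sqrt 2 * x)) * hsq

theorem sqrt_two_mul_numberWave₂ (n : Fin 2 → ℕ) (i : Fin 2) (q : Fin 2 → ℝ) :
    (Real.sqrt 2 : ℂ) * (q i : ℂ) * numberWave₂ n q =
      (Real.sqrt ((n i : ℝ) + 1) : ℂ) * numberWave₂ (n + Pi.single i 1) q +
        (Real.sqrt (n i : ℝ) : ℂ) * numberWave₂ (n - Pi.single i 1) q := by
  have h := sqrt_two_mul_numberWave (n i) (q i)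
  simp only [numberWave₂, Fin.prod_univ_two]
  norm_cast
  fin_cases i <;>
    simp only [Fin.zero_eta, Fin.mk_one, Nat.cast_add, Nat.cast_one, Pi.add_apply, Pi.sub_apply,
      Pi.single_eq_same, Pi.single_eq_of_ne zero_ne_one, Pi.single_eq_of_ne one_ne_zero, add_zero,
      tsub_zero] at h ⊢
  · linear_combination numberWave (n 1) (q 1) * h
  · linear_combination numberWave (n 0) (q 0) * h

theorem hasLineDerivAt_numberWave₂ (n : Fin 2 → ℕ) (i : Fin 2) (q : Fin 2 → ℝ) :
    HasLineDerivAt ℝ (numberWave₂ n)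
      ((q i : ℂ) * numberWave₂ n q - (Real.sqrt 2 : ℂ) *
        ((Real.sqrt ((n i : ℝ) + 1) : ℂ) * numberWave₂ (n + Pi.single i 1) q))
      q (Pi.single i 1) := by
  have hwave : HasDerivAt (fun t : ℝ => numberWave (n i) (q i + t)) _ 0 :=
    HasDerivAt.comp_const_add (q i) 0 ((add_zero (q i)).symm ▸ hasDerivAt_numberWave (n i) (q i))
  simp only [HasLineDerivAt, numberWave₂, Fin.prod_univ_two]
  norm_cast
  refine HasDerivAt.ofReal_comp ?_
  fin_cases i <;>
    simp only [Fin.zero_eta, Fin.mk_one, Nat.cast_add, Nat.cast_one, Pi.add_apply, Pi.smul_apply,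
      Pi.single_eq_same, Pi.single_eq_of_ne zero_ne_one, Pi.single_eq_of_ne one_ne_zero, add_zero,
      smul_eq_mul, mul_one, mul_zero] at hwave ⊢
  · refine (hwave.mul_const (numberWave (n 1) (q 1))).congr_deriv ?_
    ring
  · refine (hwave.const_mul (numberWave (n 0) (q 0))).congr_deriv ?_
    ring

theorem numberAmplitudes_apply (ψ : (Fin 2 → ℝ) → ℂ) (n : Fin 2 → ℕ) :
    numberAmplitudes ψ n = ∫ q, numberWave₂ n q * ψ q := rfl

section Quadratures

open MeasureTheory

variable {ψ : (Fin 2 → ℝ) → ℂ}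

theorem integrable_numberWave₂_mul (hψ : MemLp ψ 2) (n : Fin 2 → ℕ) :
    Integrable fun q => numberWave₂ n q * ψ q :=
  (memLp_numberWave₂ n).integrable_mul hψ

theorem sqrt_two_mul_numberWave₂_mul_coord_mul (ψ : (Fin 2 → ℝ) → ℂ) (n : Fin 2 → ℕ) (i : Fin 2)
    (q : Fin 2 → ℝ) :
    (Real.sqrt 2 : ℂ) * (numberWave₂ n q * (q i * ψ q)) =
      (Real.sqrt ((n i : ℝ) + 1) : ℂ) * (numberWave₂ (n + Pi.single i 1) q * ψ q) +
        (Real.sqrt (n i : ℝ) : ℂ) * (numberWave₂ (n - Pi.single i 1) q * ψ q) := by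
  linear_combination ψ q * sqrt_two_mul_numberWave₂ n i q

theorem integrable_numberWave₂_mul_coord_mul (hψ : MemLp ψ 2) (n : Fin 2 → ℕ) (i : Fin 2) :
    Integrable fun q => numberWave₂ n q * (q i * ψ q) := by
  have hsqrt : IsUnit (Real.sqrt 2 : ℂ) := by simp
  rw [← integrable_const_mul_iff hsqrt]
  simp only [sqrt_two_mul_numberWave₂_mul_coord_mul]
  exact ((integrable_numberWave₂_mul hψ _).const_mul _).add
    ((integrable_numberWave₂_mul hψ _).const_mul _)

theorem annih_add_create_numberAmplitudes (hψ : MemLp ψ 2) (i : Fin 2) :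
    annih i (numberAmplitudes ψ) + create i (numberAmplitudes ψ) =
      (Real.sqrt 2 : ℂ) • numberAmplitudes fun q => q i * ψ q := by
  funext n
  simp only [Pi.add_apply, Pi.smul_apply, smul_eq_mul, annih_apply, create_apply,
    numberAmplitudes_apply, ← integral_const_mul, sqrt_two_mul_numberWave₂_mul_coord_mul]
  exact (integral_add ((integrable_numberWave₂_mul hψ _).const_mul _)
      ((integrable_numberWave₂_mul hψ _).const_mul _)).symm

theorem sqrt_two_smul_annih_numberAmplitudes {ψ' : (Fin 2 → ℝ) → ℂ} (hψ : MemLp ψ 2) {i : Fin 2}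
    (hd : ∀ q, HasLineDerivAt ℝ ψ (ψ' q) q (Pi.single i 1))
    (hψ' : ∀ n, Integrable fun q => numberWave₂ n q * ψ' q) :
    (Real.sqrt 2 : ℂ) • annih i (numberAmplitudes ψ) =
      numberAmplitudes (fun q => q i * ψ q) + numberAmplitudes ψ' := by
  funext n
  have hleft : Integrable fun q => (Real.sqrt 2 : ℂ) *
      ((Real.sqrt ((n i : ℝ) + 1) : ℂ) * (numberWave₂ (n + Pi.single i 1) q * ψ q)) :=
    ((integrable_numberWave₂_mul hψ _).const_mul _).const_mul _
  have hcoord := integrable_numberWave₂_mul_coord_mul hψ n i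
  have hderiv (q : Fin 2 → ℝ) : ((q i : ℂ) * numberWave₂ n q - (Real.sqrt 2 : ℂ) *
        ((Real.sqrt ((n i : ℝ) + 1) : ℂ) * numberWave₂ (n + Pi.single i 1) q)) * ψ q =
      numberWave₂ n q * (q i * ψ q) - (Real.sqrt 2 : ℂ) *
        ((Real.sqrt ((n i : ℝ) + 1) : ℂ) * (numberWave₂ (n + Pi.single i 1) q * ψ q)) := by ring
  have hparts := integral_bilinear_hasLineDerivAt_right_eq_neg_left_of_integrable
    (μ := volume) (B := ContinuousLinearMap.mul ℝ ℂ) (f := numberWave₂ n) (g := ψ)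
    (v := Pi.single i 1)
    (by simp only [ContinuousLinearMap.mul_apply', hderiv]; exact hcoord.sub hleft)
    (hψ' n) (integrable_numberWave₂_mul hψ n) (fun q _ => hasLineDerivAt_numberWave₂ n i q)
    (fun q _ => hd q)
  simp only [ContinuousLinearMap.mul_apply', hderiv] at hparts
  rw [integral_sub hcoord hleft, integral_const_mul, integral_const_mul] at hparts
  simp only [Pi.add_apply, Pi.smul_apply, smul_eq_mul, annih_apply, numberAmplitudes_apply]
  linear_combination -hparts

theorem sqrt_two_smul_create_numberAmplitudes {ψ' : (Fin 2 → ℝ) → ℂ} (hψ : MemLp ψ 2) {i : Fin 2}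
    (hd : ∀ q, HasLineDerivAt ℝ ψ (ψ' q) q (Pi.single i 1))
    (hψ' : ∀ n, Integrable fun q => numberWave₂ n q * ψ' q) :
    (Real.sqrt 2 : ℂ) • create i (numberAmplitudes ψ) =
      numberAmplitudes (fun q => q i * ψ q) - numberAmplitudes ψ' := by
  have hcreate := eq_sub_of_add_eq' (annih_add_create_numberAmplitudes hψ i)
  have htwo := ofReal_sqrt_mul_self (x := 2) (by positivity)
  rw [hcreate, smul_sub, sqrt_two_smul_annih_numberAmplitudes hψ hd hψ', smul_smul, htwo]
  push_cast
  module

end Quadratures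

theorem hasLineDerivAt_gaussianWave {Z : Matrix (Fin 2) (Fin 2) ℂ} (hZ : Z.IsSymm) (i : Fin 2)
    (q : Fin 2 → ℝ) :
    HasLineDerivAt ℝ (gaussianWave Z)
      (Complex.I * (∑ j, Z i j * (q j : ℂ)) * gaussianWave Z q) q (Pi.single i 1) := by
  have hs : Z 1 0 = Z 0 1 := hZ.apply 0 1
  have hq (j : Fin 2) : HasDerivAt
      (fun t : ℝ => (((q + t • (Pi.single i 1 : Fin 2 → ℝ)) j : ℝ) : ℂ))
      (((Pi.single i 1 : Fin 2 → ℝ) j : ℝ) : ℂ) 0 := by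
    refine HasDerivAt.ofReal_comp ?_
    simpa using ((hasDerivAt_id (0 : ℝ)).mul_const ((Pi.single i 1 : Fin 2 → ℝ) j)).const_add (q j)
  have hform := (HasDerivAt.fun_sum fun j (_ : j ∈ Finset.univ) =>
    HasDerivAt.fun_sum fun k (_ : k ∈ Finset.univ) =>
      ((hq j).mul_const (Z j k)).mul (hq k)).const_mul (Complex.I / 2)
  refine (hform.cexp.const_mul
    (((Z.map Complex.im).det ^ (1 / 4 : ℝ) / Real.pi ^ (2 / 4 : ℝ) : ℝ) : ℂ)).congr_deriv ?_
  simp only [gaussianWave, Fin.sum_univ_two, Pi.mul_apply, zero_smul, add_zero, hs]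
  fin_cases i <;> simp [hs] <;> ring

section Nullifier

open MeasureTheory

variable {Z : Matrix (Fin 2) (Fin 2) ℂ}

theorem numberWave₂_mul_lineDeriv_gaussianWave (Z : Matrix (Fin 2) (Fin 2) ℂ) (n : Fin 2 → ℕ)
    (i : Fin 2) (q : Fin 2 → ℝ) :
    numberWave₂ n q * (Complex.I * (∑ j, Z i j * (q j : ℂ)) * gaussianWave Z q) =
      ∑ j, (Complex.I • Z) i j * (numberWave₂ n q * (q j * gaussianWave Z q)) := by
  simp only [Finset.mul_sum, Finset.sum_mul, Matrix.smul_apply, smul_eq_mul]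
  exact Finset.sum_congr rfl fun j _ => by ring

theorem integrable_numberWave₂_mul_lineDeriv_gaussianWave (hZ : IsGaussianGraph Z)
    (n : Fin 2 → ℕ) (i : Fin 2) : Integrable fun q : Fin 2 → ℝ =>
      numberWave₂ n q * (Complex.I * (∑ j, Z i j * (q j : ℂ)) * gaussianWave Z q) := by
  simp only [numberWave₂_mul_lineDeriv_gaussianWave]
  exact integrable_finsetSum _ fun j _ =>
    (integrable_numberWave₂_mul_coord_mul (memLp_gaussianWave hZ) n j).const_mul _

theorem numberAmplitudes_lineDeriv_gaussianWave (hZ : IsGaussianGraph Z) (i : Fin 2) :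
    numberAmplitudes (fun q => Complex.I * (∑ j, Z i j * (q j : ℂ)) * gaussianWave Z q) =
      ∑ j, (Complex.I • Z) i j • numberAmplitudes fun q => q j * gaussianWave Z q := by
  funext n
  simp only [numberAmplitudes_apply, numberWave₂_mul_lineDeriv_gaussianWave, Finset.sum_apply,
    Pi.smul_apply, smul_eq_mul]
  rw [integral_finsetSum _ fun j _ =>
    (integrable_numberWave₂_mul_coord_mul (memLp_gaussianWave hZ) n j).const_mul _]
  simp only [integral_const_mul]

theorem sqrt_two_smul_annih_gaussianWave (hZ : IsGaussianGraph Z) (i : Fin 2) :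
    (Real.sqrt 2 : ℂ) • annih i (numberAmplitudes (gaussianWave Z)) =
      ∑ j, (1 + Complex.I • Z) i j • numberAmplitudes fun q => q j * gaussianWave Z q := by
  rw [sqrt_two_smul_annih_numberAmplitudes (memLp_gaussianWave hZ)
    (hasLineDerivAt_gaussianWave hZ.symm i)
    (integrable_numberWave₂_mul_lineDeriv_gaussianWave hZ · i),
    numberAmplitudes_lineDeriv_gaussianWave hZ]
  simp only [Matrix.add_apply, add_smul, Finset.sum_add_distrib]
  simp [Matrix.one_apply]

theorem sqrt_two_smul_create_gaussianWave (hZ : IsGaussianGraph Z) (i : Fin 2) :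
    (Real.sqrt 2 : ℂ) • create i (numberAmplitudes (gaussianWave Z)) =
      ∑ j, (1 - Complex.I • Z) i j • numberAmplitudes fun q => q j * gaussianWave Z q := by
  rw [sqrt_two_smul_create_numberAmplitudes (memLp_gaussianWave hZ)
    (hasLineDerivAt_gaussianWave hZ.symm i)
    (integrable_numberWave₂_mul_lineDeriv_gaussianWave hZ · i),
    numberAmplitudes_lineDeriv_gaussianWave hZ]
  simp only [Matrix.sub_apply, sub_smul, Finset.sum_sub_distrib]
  simp [Matrix.one_apply]

end Nullifier

end Qumodes

open Matrix in
theorem re_star_dotProduct_mulVec_pos {n : Type*} [Fintype n] {A : Matrix n n ℂ} (hs : A.IsSymm)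
    (hA : (A.map Complex.re).PosDef) {v : n → ℂ} (hv : v ≠ 0) :
    0 < (star v ⬝ᵥ A *ᵥ v).re := by
  let x : n → ℝ := fun i => (v i).re
  let y : n → ℝ := fun i => (v i).im
  have hskew : x ⬝ᵥ A.map Complex.im *ᵥ y = y ⬝ᵥ A.map Complex.im *ᵥ x := by
    rw [dotProduct_mulVec, dotProduct_comm, ← mulVec_transpose, (hs.map _).eq]
  have hre : (star v ⬝ᵥ A *ᵥ v).re =
      x ⬝ᵥ A.map Complex.re *ᵥ x + y ⬝ᵥ A.map Complex.re *ᵥ y -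
        (x ⬝ᵥ A.map Complex.im *ᵥ y - y ⬝ᵥ A.map Complex.im *ᵥ x) := by
    simp only [dotProduct, mulVec, Finset.mul_sum, Complex.re_sum, ← Finset.sum_add_distrib,
      ← Finset.sum_sub_distrib]
    refine Finset.sum_congr rfl fun i _ => Finset.sum_congr rfl fun j _ => ?_
    simp only [x, y, Matrix.map_apply, Pi.star_apply, Complex.star_def, Complex.mul_re,
      Complex.mul_im, Complex.conj_re, Complex.conj_im]
    ring
  rw [hre, hskew, sub_self, sub_zero]
  have hnonneg (u : n → ℝ) : 0 ≤ u ⬝ᵥ A.map Complex.re *ᵥ u :=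
    hA.posSemidef.dotProduct_mulVec_nonneg u
  by_cases h : x = 0
  · have hy0 : y ≠ 0 := fun h' => hv (funext fun i => Complex.ext (congrFun h i) (congrFun h' i))
    exact add_pos_of_nonneg_of_pos (hnonneg x) (hA.dotProduct_mulVec_pos hy0)
  · exact add_pos_of_pos_of_nonneg (hA.dotProduct_mulVec_pos h) (hnonneg y)

theorem det_ne_zero_of_posDef_re {n : Type*} [Fintype n] [DecidableEq n] {A : Matrix n n ℂ}
    (hs : A.IsSymm) (hA : (A.map Complex.re).PosDef) : A.det ≠ 0 := fun hdet => by
  obtain ⟨v, hv, hAv⟩ := Matrix.exists_mulVec_eq_zero_iff.2 hdet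
  have hpos := re_star_dotProduct_mulVec_pos hs hA hv
  rw [hAv, dotProduct_zero, Complex.zero_re] at hpos
  exact hpos.false

theorem re_schurComplement_pos_of_posDef_re {A : Matrix (Fin 2) (Fin 2) ℂ} (hs : A.IsSymm)
    (hA : (A.map Complex.re).PosDef) : 0 < (A 1 1 - A 0 1 ^ 2 / A 0 0).re := by
  have ha : A 0 0 ≠ 0 := ne_of_apply_ne Complex.re (hA.diag_pos (i := 0)).ne'
  have hv : (![-(A 0 1 / A 0 0), 1] : Fin 2 → ℂ) ≠ 0 := fun h => one_ne_zero (congrFun h 1)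
  have hAv : A.mulVec ![-(A 0 1 / A 0 0), 1] = ![0, A 1 1 - A 0 1 ^ 2 / A 0 0] := by
    funext i
    fin_cases i <;> simp [Matrix.mulVec, dotProduct, Fin.sum_univ_two, hs.apply 0 1] <;>
      field_simp <;> ring
  simpa [hAv, dotProduct, Fin.sum_univ_two] using re_star_dotProduct_mulVec_pos hs hA hv

theorem integral_cexp_neg_quadratic_left {a : ℂ} (ha : 0 < a.re) (b c : ℂ) (y : ℝ) :
    ∫ x : ℝ, Complex.exp (-(a * x ^ 2 + 2 * b * x * y + c * y ^ 2) / 2) =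
      (Real.pi / (a / 2)) ^ (1 / 2 : ℂ) * Complex.exp (-((c - b ^ 2 / a) / 2) * y ^ 2) := by
  have ha0 : a ≠ 0 := ne_of_apply_ne Complex.re ha.ne'
  have hx (x : ℝ) : -(a * x ^ 2 + 2 * b * x * y + c * y ^ 2) / 2 =
      -(a / 2) * x ^ 2 + -(b * y) * x + -(c * y ^ 2 / 2) := by ring
  have hy : -(c * (y : ℂ) ^ 2 / 2) - (-(b * y)) ^ 2 / (4 * -(a / 2)) =
      -((c - b ^ 2 / a) / 2) * y ^ 2 := by
    field_simp
    ring
  simp only [hx]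
  rw [integral_cexp_quadratic (by simpa using ha), neg_neg, hy]

open MeasureTheory in
theorem integral_cexp_neg_quadraticForm_ne_zero {A : Matrix (Fin 2) (Fin 2) ℂ} (hs : A.IsSymm)
    (hA : (A.map Complex.re).PosDef)
    (hi : Integrable fun q : Fin 2 → ℝ =>
      Complex.exp (-(∑ i, ∑ j, (q i : ℂ) * A i j * (q j : ℂ)) / 2)) :
    ∫ q : Fin 2 → ℝ, Complex.exp (-(∑ i, ∑ j, (q i : ℂ) * A i j * (q j : ℂ)) / 2) ≠ 0 := by
  have ha : 0 < (A 0 0).re := hA.diag_pos (i := 0)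
  have hschur : 0 < ((A 1 1 - A 0 1 ^ 2 / A 0 0) / 2).re := by
    simpa using re_schurComplement_pos_of_posDef_re hs hA
  let f : ℝ × ℝ → ℂ := fun p =>
    Complex.exp (-(A 0 0 * p.1 ^ 2 + 2 * A 0 1 * p.1 * p.2 + A 1 1 * p.2 ^ 2) / 2)
  have hf (q : Fin 2 → ℝ) : Complex.exp (-(∑ i, ∑ j, (q i : ℂ) * A i j * (q j : ℂ)) / 2) =
      f (MeasurableEquiv.finTwoArrow q) := by
    simp only [f, Fin.sum_univ_two, hs.apply 0 1, MeasurableEquiv.finTwoArrow_apply]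
    ring_nf
  have hmp := volume_preserving_finTwoArrow ℝ
  have hemb := (MeasurableEquiv.finTwoArrow (α := ℝ)).measurableEmbedding
  simp only [hf] at hi ⊢
  rw [hmp.integral_comp hemb, Measure.volume_eq_prod,
    integral_prod_symm f ((hmp.integrable_comp_emb hemb).1 hi)]
  simp only [f, integral_cexp_neg_quadratic_left ha]
  rw [integral_const_mul, integral_gaussian_complex hschur]
  have hpi : (Real.pi : ℂ) ≠ 0 := Complex.ofReal_ne_zero.2 Real.pi_ne_zero
  have hhalf : (1 / 2 : ℂ) ≠ 0 := by norm_num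
  exact mul_ne_zero
    ((Complex.cpow_ne_zero_iff_of_exponent_ne_zero hhalf).2 <| div_ne_zero hpi <|
      div_ne_zero (ne_of_apply_ne Complex.re ha.ne') two_ne_zero)
    ((Complex.cpow_ne_zero_iff_of_exponent_ne_zero hhalf).2 <| div_ne_zero hpi <|
      ne_of_apply_ne Complex.re hschur.ne')

namespace Qumodes

section Gaussian

open MeasureTheory

variable {Z : Matrix (Fin 2) (Fin 2) ℂ}

theorem IsGaussianGraph.isSymm_one_sub_I_smul (hZ : IsGaussianGraph Z) :
    (1 - Complex.I • Z).IsSymm :=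
  Matrix.isSymm_one.sub (hZ.symm.smul _)

theorem IsGaussianGraph.posDef_re_one_sub_I_smul (hZ : IsGaussianGraph Z) :
    ((1 - Complex.I • Z).map Complex.re).PosDef := by
  have hre : (1 - Complex.I • Z).map Complex.re = 1 + Z.map Complex.im := by
    ext i j
    simp [Matrix.one_apply, apply_ite Complex.re]
  rw [hre]
  exact Matrix.PosDef.one.add hZ.posDef

theorem isNullified_adjacency (hZ : IsGaussianGraph Z) :
    IsNullified (adjacency Z) (numberAmplitudes (gaussianWave Z)) := by
  have hunit : IsUnit (1 - Complex.I • Z).det :=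
    (det_ne_zero_of_posDef_re hZ.isSymm_one_sub_I_smul hZ.posDef_re_one_sub_I_smul).isUnit
  have hK : adjacency Z * (1 - Complex.I • Z) = 1 + Complex.I • Z :=
    Matrix.nonsing_inv_mul_cancel_right _ _ hunit
  have hsqrt : (Real.sqrt 2 : ℂ) ≠ 0 := by simp
  refine fun i => smul_right_injective _ hsqrt ?_
  simp only [Finset.smul_sum, smul_comm (Real.sqrt 2 : ℂ) (adjacency Z i _),
    sqrt_two_smul_annih_gaussianWave hZ, sqrt_two_smul_create_gaussianWave hZ, smul_smul]
  rw [Finset.sum_comm]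
  simp only [← Finset.sum_smul, ← Matrix.mul_apply, hK]

theorem numberWave₂_zero (q : Fin 2 → ℝ) :
    numberWave₂ 0 q = (((Real.pi ^ (1 / 4 : ℝ))⁻¹ ^ 2 : ℝ) : ℂ) *
      Complex.exp (-(∑ i, (q i : ℂ) ^ 2) / 2) := by
  rw [neg_div, Finset.sum_div, ← Finset.sum_neg_distrib, Complex.exp_sum]
  simp only [numberWave₂, numberWave, Fin.prod_univ_two, Pi.zero_apply, Polynomial.hermite_zero,
    map_one, Nat.factorial_zero, Nat.cast_one, Real.sqrt_one, mul_one, one_mul]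
  push_cast
  ring_nf

theorem numberWave₂_zero_mul_gaussianWave (Z : Matrix (Fin 2) (Fin 2) ℂ) (q : Fin 2 → ℝ) :
    numberWave₂ 0 q * gaussianWave Z q =
      (((Real.pi ^ (1 / 4 : ℝ))⁻¹ ^ 2 * ((Z.map Complex.im).det ^ (1 / 4 : ℝ) /
        Real.pi ^ (2 / 4 : ℝ)) : ℝ) : ℂ) *
        Complex.exp (-(∑ i, ∑ j, (q i : ℂ) * (1 - Complex.I • Z) i j * (q j : ℂ)) / 2) := by
  rw [numberWave₂_zero, gaussianWave, mul_mul_mul_comm, ← Complex.ofReal_mul, ← Complex.exp_add]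
  congr 2
  simp only [Fin.sum_univ_two, Matrix.sub_apply, Matrix.smul_apply, Matrix.one_apply_eq,
    Matrix.one_apply_ne zero_ne_one, Matrix.one_apply_ne one_ne_zero, smul_eq_mul]
  ring

theorem numberAmplitudes_gaussianWave_zero_ne_zero (hZ : IsGaussianGraph Z) :
    numberAmplitudes (gaussianWave Z) 0 ≠ 0 := by
  have hdet : 0 < (Z.map Complex.im).det := hZ.posDef.det_pos
  have hN : ((((Real.pi ^ (1 / 4 : ℝ))⁻¹ ^ 2 * ((Z.map Complex.im).det ^ (1 / 4 : ℝ) /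
      Real.pi ^ (2 / 4 : ℝ)) : ℝ)) : ℂ) ≠ 0 :=
    Complex.ofReal_ne_zero.2 (by positivity)
  have hi := integrable_numberWave₂_mul (memLp_gaussianWave hZ) 0
  rw [numberAmplitudes_apply]
  simp only [numberWave₂_zero_mul_gaussianWave] at hi ⊢
  rw [integral_const_mul]
  exact mul_ne_zero hN (integral_cexp_neg_quadraticForm_ne_zero hZ.isSymm_one_sub_I_smul
    hZ.posDef_re_one_sub_I_smul ((integrable_const_mul_iff hN.isUnit _).1 hi))

end Gaussian

theorem passiveUnitary_gaussianState_eq_self_iff {α β γ δ : ℝ} {Z : Matrix (Fin 2) (Fin 2) ℂ}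
    {hZ : IsGaussianGraph Z} :
    passiveUnitary α β γ δ (gaussianState Z hZ) = gaussianState Z hZ ↔
      evolve α β γ δ (numberAmplitudes (gaussianWave Z)) = numberAmplitudes (gaussianWave Z) :=
  Subtype.ext_iff

end Qumodes

end

theorem theorem4_general (α β γ δ : ℝ) {K : Matrix (Fin 2) (Fin 2) ℂ} {c : Qumodes.Amplitudes}
    (hc : Qumodes.IsNullified K c) (h0 : c 0 ≠ 0) :
    (Qumodes.Constraints α β γ δ K → Qumodes.evolve α β γ δ c = c) ∧
    ((∀ k : ℤ, k ≠ 0 → α ≠ 2 * Real.pi * k ∧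
        α + Real.sqrt (β ^ 2 + γ ^ 2 + δ ^ 2) ≠ 2 * Real.pi * k ∧
        α - Real.sqrt (β ^ 2 + γ ^ 2 + δ ^ 2) ≠ 2 * Real.pi * k) →
      (Qumodes.evolve α β γ δ c = c ↔ Qumodes.Constraints α β γ δ K)) ∧
    ((∀ θ : ℝ, Qumodes.evolve (θ * α) (θ * β) (θ * γ) (θ * δ) c = c) ↔
      Qumodes.Constraints α β γ δ K) := by
  have hfix (h : Qumodes.Constraints α β γ δ K) : Qumodes.evolve α β γ δ c = c :=
    Qumodes.evolve_eq_self_of_generator_eq_zero ((hc.generator_eq_zero_iff h0).2 h)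
  refine ⟨hfix, fun hr => ⟨hc.constraints_of_evolve_eq_self h0 hr, hfix⟩, ?_⟩
  rw [Qumodes.forall_evolve_eq_self_iff, hc.generator_eq_zero_iff h0]

theorem theorem4 (α β γ δ : ℝ) (Z : Matrix (Fin 2) (Fin 2) ℂ) (hZ : Qumodes.IsGaussianGraph Z) :
    -- the constraints always imply invariance under `U`
    (Qumodes.Constraints α β γ δ (Qumodes.adjacency Z) →
      Qumodes.passiveUnitary α β γ δ (Qumodes.gaussianState Z hZ) = Qumodes.gaussianState Z hZ) ∧
    -- they characterize invariance under `U`, unless one of the three phases `e^{-iα}`,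
    -- `e^{-i(α ± r)}`, `r = √(β² + γ² + δ²)`, is a nontrivial return to 1
    ((∀ k : ℤ, k ≠ 0 → α ≠ 2 * Real.pi * k ∧
        α + Real.sqrt (β ^ 2 + γ ^ 2 + δ ^ 2) ≠ 2 * Real.pi * k ∧
        α - Real.sqrt (β ^ 2 + γ ^ 2 + δ ^ 2) ≠ 2 * Real.pi * k) →
      (Qumodes.passiveUnitary α β γ δ (Qumodes.gaussianState Z hZ) = Qumodes.gaussianState Z hZ ↔
        Qumodes.Constraints α β γ δ (Qumodes.adjacency Z))) ∧
    -- they always characterize invariance under `U(θ)` for all `θ`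
    ((∀ θ : ℝ, Qumodes.passiveUnitary (θ * α) (θ * β) (θ * γ) (θ * δ) (Qumodes.gaussianState Z hZ) =
        Qumodes.gaussianState Z hZ) ↔
      Qumodes.Constraints α β γ δ (Qumodes.adjacency Z)) := by
  simpa only [Qumodes.passiveUnitary_gaussianState_eq_self_iff] using theorem4_general α β γ δ
    (Qumodes.isNullified_adjacency hZ) (Qumodes.numberAmplitudes_gaussianWave_zero_ne_zero hZ)
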